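/- Let $K$ be a field of characteristic $0$, let $G$ be a group (for instance the group of points of a reductive algebraic group), and let $V$ be a finite-dimensional representation of $G$ over $K$. For $r\ge 0$ the symmetric group $\mathfrak S_r$ acts on $V^{\otimes r}$ by permuting the tensor factors, and this action preserves the subspace $(V^{\otimes r})^G$ of invariants of the diagonal $G$-action. Let $$I_r(V)=\frac1{r!}\sum_{\pi\in\mathfrak S_r}\operatorname{Tr}\bigl(\pi\mid (V^{\otimes r})^G\bigr)\,p_{\lambda(\pi)}$$ be the Frobenius character of this representation of $\mathfrak S_r$, where $\lambda(\pi)$ is the cycle type of $\pi$ and $p_\lambda$ is the power sum symmetric function; it lies in the ring $\Lambda_K$ of symmetric functions over $K$. Let $P$ be a homogeneous polynomial functor of degree $k\ge 0$, that is, a functor from finite-dimensional $K$-vector spaces to themselves such that every map $\operatorname{Hom}(U,W)\to\operatorname{Hom}(P(U),P(W))$, $f\mapsto P(f)$, is a homogeneous polynomial map of degree $k$; the representation $P(V)$ of $G$ is given by $g\mapsto P(g)$. Then there is a unique symmetric function $\mathbf{ch}\,P\in\Lambda_K$, the character of $P$, such that $(\mathbf{ch}\,P)(a_1,\dots,a_n,0,0,\dots)=\operatorname{Tr}P(A)$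 for every $n\ge 0$ and every invertible diagonal matrix $A$ with diagonal entries $a_1,\dots,a_n$; and for every $r\ge 0$ $$I_r(P(V))[X]=\bigl\langle h_r[X\cdot \mathbf{ch}\,P[Y]],\ I_{rk}(V)[Y]\bigr\rangle_Y .$$ Here $X$ and $Y$ are two distinct alphabets, $h_r$ is the complete symmetric function, and square brackets denote plethysm: $f\mapsto f[X\cdot F[Y]]$ is the $K$-algebra homomorphism with $p_n[X\cdot F[Y]]=p_n[X]\cdot (p_n[F])[Y]$, where $F\mapsto p_n[F]$ is the $K$-algebra homomorphism with $p_n[p_m]=p_{mn}$. Finally $\langle\ ,\ \rangle_Y$ is the standard scalar product of symmetric functions, $\langle p_\lambda,p_\mu\rangle=z_\lambda\delta_{\lambda\mu}$, taken in the alphabet $Y$ and extended linearly over the symmetric functions of $X$. -/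

import Mathlib

namespace SymFun

open MvPolynomial in
theorem esymm_mem_adjoin_psum (K : Type*) [Field K] [CharZero K] (N : ℕ) (j : ℕ) (hj : j ≤ N) :
    esymm (Fin N) K j ∈
      (aeval (fun i : Fin N => psum (Fin N) K (i + 1)) :
        MvPolynomial (Fin N) K →ₐ[K] MvPolynomial (Fin N) K).range := by
  induction j using Nat.strong_induction_on with
  | _ j ih =>
    rcases Nat.eq_zero_or_pos j with rfl | hpos
    · rw [esymm_zero]; exact Subalgebra.one_mem _
    have h := mul_esymm_eq_sum (Fin N) K j
    have h1 : esymm (Fin N) K j = (j : K)⁻¹ • ((j : MvPolynomial (Fin N) K) * esymm (Fin N) K j) := by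
      rw [MvPolynomial.smul_eq_C_mul, ← mul_assoc]
      have : (C ((j : K)⁻¹) * (j : MvPolynomial (Fin N) K)) = 1 := by
        rw [← map_natCast (C : K →+* MvPolynomial (Fin N) K), ← C_mul,
          inv_mul_cancel₀ (by exact_mod_cast hpos.ne'), C_1]
      rw [this, one_mul]
    rw [h1, h]
    refine Subalgebra.smul_mem _ (Subalgebra.mul_mem _ ?_ (Subalgebra.sum_mem _ ?_)) _
    · exact Subalgebra.pow_mem _ (Subalgebra.neg_mem _ (Subalgebra.one_mem _)) _
    · rintro ⟨a, b⟩ hab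
      rw [Finset.mem_filter] at hab
      have hab1 : a + b = j := Finset.HasAntidiagonal.mem_antidiagonal.1 hab.1
      have hab2 : a < j := hab.2
      refine Subalgebra.mul_mem _ (Subalgebra.mul_mem _
        (Subalgebra.pow_mem _ (Subalgebra.neg_mem _ (Subalgebra.one_mem _)) _)
        (ih a hab2 (by omega))) ?_
      refine ⟨X ⟨b - 1, by omega⟩, ?_⟩
      have : b - 1 + 1 = b := by omega
      simp [this]

open MvPolynomial in
theorem exists_aeval_psum_eq (K : Type*) [Field K] [CharZero K] (N : ℕ)
    (q : MvPolynomial (Fin N) K) (hq : q.IsSymmetric) :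
    ∃ g : MvPolynomial (Fin N) K, aeval (fun i : Fin N => psum (Fin N) K (i + 1)) g = q := by
  obtain ⟨g, hg⟩ := esymmAlgHom_surjective (σ := Fin N) (n := N) K (by simp) ⟨q, hq⟩
  have hg' : aeval (fun i : Fin N => esymm (Fin N) K (i + 1)) g = q := by
    rw [← esymmAlgHom_apply, hg]
  have hle : (aeval (fun i : Fin N => esymm (Fin N) K (i + 1)) :
      MvPolynomial (Fin N) K →ₐ[K] MvPolynomial (Fin N) K).range ≤
      (aeval (fun i : Fin N => psum (Fin N) K (i + 1)) :
        MvPolynomial (Fin N) K →ₐ[K] MvPolynomial (Fin N) K).range := by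
    rw [← Algebra.adjoin_range_eq_range_aeval]
    refine Algebra.adjoin_le ?_
    rintro _ ⟨i, rfl⟩
    exact esymm_mem_adjoin_psum K N _ i.2
  exact hle ⟨g, hg'⟩

theorem injective_of_surjective_noetherian {R : Type*} [CommRing R] [IsNoetherianRing R] (f : R →+* R)
    (hf : Function.Surjective f) : Function.Injective f := by
  have hmono : Monotone (fun n : ℕ => RingHom.ker ((f ^ n : R →+* R))) := by
    refine monotone_nat_of_le_succ fun n x hx => ?_
    rw [RingHom.mem_ker] at hx ⊢
    rw [pow_succ', RingHom.mul_def, RingHom.comp_apply, hx, map_zero]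
  obtain ⟨n, hn⟩ := monotone_stabilizes_iff_noetherian.2 (inferInstance : IsNoetherian R R)
    ⟨_, hmono⟩
  rw [injective_iff_map_eq_zero]
  intro x hx
  have hs : Function.Surjective (f ^ n : R →+* R) := by
    rw [RingHom.coe_pow]; exact hf.iterate n
  obtain ⟨y, rfl⟩ := hs x
  have h1 : y ∈ RingHom.ker (f ^ (n+1) : R →+* R) := by
    rw [RingHom.mem_ker, pow_succ', RingHom.mul_def, RingHom.comp_apply, hx]
  have h2 := hn (n+1) (by omega)
  simp only [OrderHom.coe_mk] at h2
  rw [← h2] at h1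
  exact h1

open MvPolynomial in
theorem aeval_psum_injective (K : Type*) [Field K] [CharZero K] (N : ℕ) :
    Function.Injective (aeval (fun i : Fin N => psum (Fin N) K (i + 1)) :
        MvPolynomial (Fin N) K →ₐ[K] MvPolynomial (Fin N) K) := by
  set ψ : MvPolynomial (Fin N) K →ₐ[K] symmetricSubalgebra (Fin N) K :=
    aeval (fun i : Fin N => ⟨psum (Fin N) K (i + 1), psum_isSymmetric _ _ _⟩) with hψ
  have hψv : ∀ g, (ψ g : MvPolynomial (Fin N) K) =
      aeval (fun i : Fin N => psum (Fin N) K (i + 1)) g := fun g => by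
    rw [hψ]; exact (Subalgebra.mvPolynomial_aeval_coe _ _ _).symm
  have hs : Function.Surjective ψ := by
    rintro ⟨q, hq⟩
    obtain ⟨g, hg⟩ := exists_aeval_psum_eq K N q hq
    exact ⟨g, Subtype.ext ((hψv g).trans hg)⟩
  let E := esymmAlgEquiv (Fin N) K (n := N) (by simp)
  have hi := injective_of_surjective_noetherian (E.symm.toRingEquiv.toRingHom.comp ψ.toRingHom) (E.symm.surjective.comp hs)
  intro a b hab
  apply hi
  have : ψ a = ψ b := Subtype.ext (by rw [hψv, hψv, hab])
  simp [this]

end SymFun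

open MvPowerSeries in
/-- The ring of symmetric functions over `K` in the variables `x₀, x₁, x₂, …`: formal power series
of bounded degree that are invariant under all permutations of the variables. -/
noncomputable def SymFun (K : Type*) [Field K] : Subalgebra K (MvPowerSeries ℕ K) where
  carrier := {f | (∃ d : ℕ, ∀ α : ℕ →₀ ℕ, coeff α f ≠ 0 → α.degree ≤ d) ∧
    ∀ σ : Equiv.Perm ℕ, renameEquiv K σ f = f}
  mul_mem' := by
    classical
    rintro f g ⟨⟨d, hd⟩, hf⟩ ⟨⟨e, he⟩, hg⟩
    refine ⟨⟨d + e, fun α hα => ?_⟩, fun σ => by rw [map_mul, hf, hg]⟩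
    rw [coeff_mul] at hα
    obtain ⟨⟨a, b⟩, hab, h⟩ := Finset.exists_ne_zero_of_sum_ne_zero hα
    rw [Finset.HasAntidiagonal.mem_antidiagonal] at hab
    simp only at hab h
    rw [← hab, map_add]
    exact add_le_add (hd _ (left_ne_zero_of_mul h)) (he _ (right_ne_zero_of_mul h))
  add_mem' := by
    rintro f g ⟨⟨d, hd⟩, hf⟩ ⟨⟨e, he⟩, hg⟩
    refine ⟨⟨max d e, fun α hα => ?_⟩, fun σ => by rw [map_add, hf, hg]⟩
    by_contra hc
    rw [not_le, max_lt_iff] at hc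
    apply hα
    rw [map_add, not_not.1 (mt (hd α) (not_le.2 hc.1)), not_not.1 (mt (he α) (not_le.2 hc.2)),
      add_zero]
  algebraMap_mem' := by
    classical
    intro c
    refine ⟨⟨0, fun α hα => ?_⟩, fun σ => AlgEquiv.commutes _ _⟩
    rw [MvPowerSeries.algebraMap_apply, coeff_C] at hα
    by_cases h : α = 0
    · simp [h]
    · simp [h] at hα

namespace SymFun

variable (K : Type*) [Field K]

open MvPowerSeries in
theorem mem_of_coeff (f : MvPowerSeries ℕ K) (d : ℕ)
    (h1 : ∀ α : ℕ →₀ ℕ, coeff α f ≠ 0 → α.degree ≤ d)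
    (h2 : ∀ (σ : Equiv.Perm ℕ) (α : ℕ →₀ ℕ),
      coeff (Finsupp.embDomain σ.toEmbedding α) f = coeff α f) : f ∈ SymFun K := by
  refine ⟨⟨d, h1⟩, fun σ => ?_⟩
  ext α
  obtain ⟨β, rfl⟩ : ∃ β, α = Finsupp.embDomain σ.toEmbedding β :=
    ⟨Finsupp.embDomain σ.symm.toEmbedding α, by
      ext i
      obtain ⟨j, rfl⟩ := σ.surjective i
      have := Finsupp.embDomain_apply_self σ.symm.toEmbedding α (σ j)
      have h3 := Finsupp.embDomain_apply_self σ.toEmbedding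
        (Finsupp.embDomain σ.symm.toEmbedding α) j
      simp at this h3
      rw [h3, this]⟩
  rw [h2]
  exact coeff_embDomain_rename σ.toEmbedding f β

open Classical in
/-- The power sum symmetric function `p_n = ∑ xᵢ ^ n` (for `n ≥ 1`). -/
noncomputable def p (n : ℕ) : SymFun K :=
  ⟨fun α => if ∃ i, α = Finsupp.single i n then 1 else 0, by
    apply mem_of_coeff K _ n
    · intro α hα
      have : ∃ i, α = Finsupp.single i n := by
        by_contra h
        exact hα (if_neg h)
      obtain ⟨i, rfl⟩ := this
      simp
    · intro σ α
      change (if _ then _ else _) = (if _ then _ else _)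
      congr 1
      apply propext
      constructor
      · rintro ⟨i, h⟩
        refine ⟨σ.symm i, ?_⟩
        apply Finsupp.embDomain_injective σ.toEmbedding
        rw [h, Finsupp.embDomain_single]
        simp
      · rintro ⟨i, rfl⟩
        exact ⟨σ i, by rw [Finsupp.embDomain_single]; simp⟩⟩

open Classical in
/-- The complete symmetric function `h_n`, the sum of all monomials of degree `n`. -/
noncomputable def h (n : ℕ) : SymFun K :=
  ⟨fun α => if α.degree = n then 1 else 0, by
    apply mem_of_coeff K _ n
    · intro α hα
      by_contra h
      exact hα (if_neg (by omega))
    · intro σ α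
      change (if _ then _ else _) = (if _ then _ else _)
      congr 2
      rw [Finsupp.degree_apply, Finsupp.degree_apply, Finsupp.support_embDomain, Finset.sum_map]
      exact Finset.sum_congr rfl fun i _ => Finsupp.embDomain_apply_self _ _ _⟩

/-- The algebra homomorphism from the polynomial ring on `ℕ+` that sends the `n`-th variable to
`p_n`. -/
noncomputable def ofPowerSums : MvPolynomial ℕ+ K →ₐ[K] SymFun K :=
  MvPolynomial.aeval fun n : ℕ+ => p K n

/-- Restriction to the first `N` variables, the other variables being set to `0`. -/
noncomputable def restrict (N : ℕ) : SymFun K →ₐ[K] MvPowerSeries (Fin N) K :=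
  (MvPowerSeries.killCompl Fin.valEmbedding).comp (SymFun K).val

open MvPowerSeries in
theorem coeff_restrict (N : ℕ) (f : SymFun K) (β : Fin N →₀ ℕ) :
    coeff β (restrict K N f) = coeff (β.embDomain Fin.valEmbedding) (f : MvPowerSeries ℕ K) :=
  coeff_killCompl _ _

theorem restrict_p (N n : ℕ) (hn : 0 < n) :
    restrict K N (p K n) = ((MvPolynomial.psum (Fin N) K n : MvPolynomial (Fin N) K) :
      MvPowerSeries (Fin N) K) := by
  classical
  ext β
  rw [coeff_restrict, MvPolynomial.coeff_coe, MvPolynomial.psum, MvPolynomial.coeff_sum]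
  simp only [MvPolynomial.coeff_X_pow]
  change (if _ then _ else _) = _
  split_ifs with h
  · obtain ⟨i, hi⟩ := h
    have hiN : i ∈ Set.range (Fin.valEmbedding : Fin N ↪ ℕ) := by
      by_contra hc
      have h0 := Finsupp.embDomain_of_notMem_range Fin.valEmbedding β i hc
      rw [hi, Finsupp.single_eq_same] at h0
      omega
    obtain ⟨j, rfl⟩ := hiN
    rw [← Finsupp.embDomain_single] at hi
    obtain rfl := Finsupp.embDomain_injective _ hi
    rw [Finset.sum_eq_single j]
    · simp
    · intro b _ hb
      rw [if_neg]
      intro hc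
      rw [Finsupp.single_eq_single_iff] at hc
      rcases hc with hc | hc
      · exact hb hc.1
      · omega
    · simp
  · symm
    apply Finset.sum_eq_zero
    intro i _
    rw [if_neg]
    rintro rfl
    exact h ⟨i, by rw [Finsupp.embDomain_single]; rfl⟩

theorem restrict_ofPowerSums (N : ℕ) (g : MvPolynomial (Fin N) K) :
    restrict K N (ofPowerSums K (MvPolynomial.rename (fun i : Fin N => Nat.succPNat i) g))
      = ((MvPolynomial.aeval (fun i : Fin N => MvPolynomial.psum (Fin N) K (i + 1)) g :
        MvPolynomial (Fin N) K) : MvPowerSeries (Fin N) K) := by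
  induction g using MvPolynomial.induction_on with
  | C a =>
    rw [MvPolynomial.rename_C, ← MvPolynomial.algebraMap_eq, AlgHom.commutes, AlgHom.commutes, MvPolynomial.aeval_C,
      MvPolynomial.algebraMap_eq, MvPolynomial.coe_C]
    rfl
  | add p q hp hq => simp only [map_add, MvPolynomial.coe_add, hp, hq]
  | mul_X p i hp =>
    rw [map_mul, map_mul, map_mul, map_mul, MvPolynomial.coe_mul, hp, MvPolynomial.rename_X,
      MvPolynomial.aeval_X, ofPowerSums, MvPolynomial.aeval_X, ← restrict_p K N (i + 1) (by omega)]
    rfl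

/-- A symmetric function of degree at most `N` is determined by its restriction to `N` variables. -/
theorem eq_zero_of_restrict (N : ℕ) (f : SymFun K)
    (hd : ∀ α : ℕ →₀ ℕ, MvPowerSeries.coeff α (f : MvPowerSeries ℕ K) ≠ 0 → α.degree ≤ N)
    (hf : restrict K N f = 0) : f = 0 := by
  apply Subtype.ext
  ext α
  by_contra hne
  have hα := hd α hne
  have hcard : α.support.card ≤ N := by
    refine le_trans ?_ hα
    rw [Finsupp.degree_apply, Finset.card_eq_sum_ones]
    exact Finset.sum_le_sum fun i hi => Nat.one_le_iff_ne_zero.2 (Finsupp.mem_support_iff.1 hi)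
  obtain ⟨σ, hσ⟩ : ∃ σ : Equiv.Perm ℕ, ∀ i ∈ α.support, σ i < N := by
    have e : {i // i ∈ α.support} ≃ {i // i ∈ Finset.range α.support.card} :=
      Finset.equivOfCardEq (by simp)
    have h1 (s : Finset ℕ) : Infinite {i // ¬ i ∈ s} := s.finite_toSet.infinite_compl.to_subtype
    have := h1 α.support
    have := h1 (Finset.range α.support.card)
    obtain ⟨e'⟩ : Nonempty ({i // ¬ i ∈ α.support} ≃
        {i // ¬ i ∈ Finset.range α.support.card}) := nonempty_equiv_of_countable
    refine ⟨Equiv.subtypeCongr e e', fun i hi => ?_⟩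
    have h2 : Equiv.subtypeCongr e e' i = e ⟨i, hi⟩ := by
      simp [Equiv.subtypeCongr, Equiv.sumCompl_symm_apply_of_pos hi]
    rw [h2]
    exact lt_of_lt_of_le (Finset.mem_range.1 (e ⟨i, hi⟩).2) hcard
  have hsym : MvPowerSeries.coeff (α.embDomain σ.toEmbedding) (f : MvPowerSeries ℕ K) =
      MvPowerSeries.coeff α (f : MvPowerSeries ℕ K) := by
    conv_lhs => rw [← f.2.2 σ]
    exact MvPowerSeries.coeff_embDomain_rename σ.toEmbedding _ α
  obtain ⟨β, hβ⟩ : ∃ β : Fin N →₀ ℕ,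
      β.embDomain Fin.valEmbedding = α.embDomain σ.toEmbedding := by
    have : α.embDomain σ.toEmbedding ∈ Set.range (Finsupp.embDomain (Fin.valEmbedding (n := N))) := by
      rw [Finsupp.mem_range_embDomain_iff, Finsupp.support_embDomain]
      intro j hj
      simp only [Finset.coe_map, Set.mem_image] at hj
      obtain ⟨i, hi, rfl⟩ := hj
      exact ⟨⟨σ i, hσ i hi⟩, rfl⟩
    exact this
  apply hne
  rw [← hsym, ← hβ, ← coeff_restrict, hf, map_zero]
  rfl

theorem ofPowerSums_injective [CharZero K] : Function.Injective (ofPowerSums K) := by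
  rw [injective_iff_map_eq_zero]
  intro q hq
  obtain ⟨N, hN⟩ : ∃ N : ℕ, ∀ n ∈ q.vars, (n : ℕ) ≤ N :=
    ⟨q.vars.sup (fun n : ℕ+ => (n : ℕ)),
      fun n hn => Finset.le_sup (f := fun n : ℕ+ => (n : ℕ)) hn⟩
  obtain ⟨g, rfl⟩ := MvPolynomial.exists_rename_eq_of_vars_subset_range q
    (fun i : Fin N => Nat.succPNat i)
    (fun a b hab => Fin.ext (by simpa using congrArg PNat.val hab))
    (fun n hn => by
      have h1 : (n : ℕ) ≤ N := hN n hn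
      have h2 := n.pos
      exact ⟨⟨n - 1, by omega⟩, PNat.eq (by rw [Nat.succPNat_coe]; simp only; omega)⟩)
  have h := restrict_ofPowerSums K N g
  rw [hq, map_zero] at h
  have h2 : MvPolynomial.aeval (fun i : Fin N => MvPolynomial.psum (Fin N) K (i + 1)) g = 0 := by
    apply MvPolynomial.coe_injective
    rw [← h, MvPolynomial.coe_zero]
  rw [(injective_iff_map_eq_zero _).1 (aeval_psum_injective K N) g h2, map_zero]

/-- A product of power sums is homogeneous. -/
theorem degree_le_of_monomial (m : ℕ+ →₀ ℕ) (α : ℕ →₀ ℕ)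
    (hα : MvPowerSeries.coeff α
      (ofPowerSums K (MvPolynomial.monomial m 1) : MvPowerSeries ℕ K) ≠ 0) :
    α.degree = Finsupp.weight (fun n : ℕ+ => (n : ℕ)) m := by
  classical
  induction m using Finsupp.induction_linear generalizing α with
  | zero =>
    have : (MvPolynomial.monomial (0 : ℕ+ →₀ ℕ)) (1 : K) = 1 := rfl
    rw [this, map_one, OneMemClass.coe_one, MvPowerSeries.coeff_one] at hα
    by_cases h : α = 0
    · simp [h]
    · simp [h] at hα
  | add m m' hm hm' =>
    have : (MvPolynomial.monomial (m + m')) (1 : K) =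
        MvPolynomial.monomial m 1 * MvPolynomial.monomial m' 1 := by
      rw [MvPolynomial.monomial_mul, one_mul]
    rw [this, map_mul, MulMemClass.coe_mul, MvPowerSeries.coeff_mul] at hα
    obtain ⟨⟨a, b⟩, hab, h⟩ := Finset.exists_ne_zero_of_sum_ne_zero hα
    rw [Finset.HasAntidiagonal.mem_antidiagonal] at hab
    simp only at hab h
    rw [← hab, map_add, map_add, hm _ (left_ne_zero_of_mul h), hm' _ (right_ne_zero_of_mul h)]
  | single n k =>
    induction k generalizing α with
    | zero =>
      rw [Finsupp.single_zero] at hα ⊢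
      have : (MvPolynomial.monomial (0 : ℕ+ →₀ ℕ)) (1 : K) = 1 := rfl
      rw [this, map_one, OneMemClass.coe_one, MvPowerSeries.coeff_one] at hα
      by_cases h : α = 0
      · simp [h]
      · simp [h] at hα
    | succ k ih =>
      have : (MvPolynomial.monomial (Finsupp.single n (k + 1))) (1 : K) =
          MvPolynomial.monomial (Finsupp.single n k) 1 * MvPolynomial.X n := by
        rw [MvPolynomial.X, MvPolynomial.monomial_mul, one_mul, Finsupp.single_add]
      rw [this, map_mul, MulMemClass.coe_mul, MvPowerSeries.coeff_mul] at hα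
      obtain ⟨⟨a, b⟩, hab, h⟩ := Finset.exists_ne_zero_of_sum_ne_zero hα
      rw [Finset.HasAntidiagonal.mem_antidiagonal] at hab
      simp only at hab h
      have hb : b.degree = n := by
        have h3 := right_ne_zero_of_mul h
        rw [ofPowerSums, MvPolynomial.aeval_X] at h3
        obtain ⟨i, rfl⟩ : ∃ i, b = Finsupp.single i (n : ℕ) := by
          by_contra hc
          exact h3 (if_neg hc)
        simp
      rw [← hab, map_add, ih _ (left_ne_zero_of_mul h), hb, Finsupp.single_add, map_add]
      simp [Finsupp.weight_single]

theorem coeff_ofPowerSums (t : MvPolynomial ℕ+ K) (α : ℕ →₀ ℕ) :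
    MvPowerSeries.coeff α (ofPowerSums K t : MvPowerSeries ℕ K) =
      ∑ m ∈ t.support, MvPolynomial.coeff m t * MvPowerSeries.coeff α
        (ofPowerSums K (MvPolynomial.monomial m 1) : MvPowerSeries ℕ K) := by
  conv_lhs => rw [t.as_sum, map_sum, AddSubmonoidClass.coe_finsetSum, map_sum]
  refine Finset.sum_congr rfl fun m _ => ?_
  have : MvPolynomial.monomial m (MvPolynomial.coeff m t) =
      (MvPolynomial.coeff m t) • MvPolynomial.monomial m (1 : K) := by
    rw [MvPolynomial.smul_monomial, smul_eq_mul, mul_one]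
  rw [this, map_smul, SetLike.val_smul, map_smul, smul_eq_mul]

theorem exists_trunc (t : MvPolynomial ℕ+ K) (d : ℕ) : ∃ t' : MvPolynomial ℕ+ K,
    ∀ α : ℕ →₀ ℕ, MvPowerSeries.coeff α (ofPowerSums K t' : MvPowerSeries ℕ K) =
      if α.degree ≤ d then MvPowerSeries.coeff α (ofPowerSums K t : MvPowerSeries ℕ K) else 0 := by
  classical
  refine ⟨∑ m ∈ t.support.filter (fun m => Finsupp.weight (fun n : ℕ+ => (n : ℕ)) m ≤ d),
    MvPolynomial.coeff m t • MvPolynomial.monomial m 1, fun α => ?_⟩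
  rw [coeff_ofPowerSums K t, map_sum, AddSubmonoidClass.coe_finsetSum, map_sum,
    Finset.sum_filter]
  have hterm (m : ℕ+ →₀ ℕ) : MvPowerSeries.coeff α ((ofPowerSums K) (MvPolynomial.coeff m t •
      MvPolynomial.monomial m 1) : MvPowerSeries ℕ K) = MvPolynomial.coeff m t *
      MvPowerSeries.coeff α ((ofPowerSums K) (MvPolynomial.monomial m 1) : MvPowerSeries ℕ K) := by
    rw [map_smul, SetLike.val_smul, map_smul, smul_eq_mul]
  simp only [hterm]
  have hz (m : ℕ+ →₀ ℕ) (hm : α.degree ≠ Finsupp.weight (fun n : ℕ+ => (n : ℕ)) m) :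
      MvPowerSeries.coeff α ((ofPowerSums K) (MvPolynomial.monomial m 1) : MvPowerSeries ℕ K) = 0 :=
    not_not.1 (mt (degree_le_of_monomial K m α) hm)
  split_ifs with hα
  · refine Finset.sum_congr rfl fun m _ => ?_
    split_ifs with hm
    · rfl
    · rw [hz m (by omega), mul_zero]
  · refine Finset.sum_eq_zero fun m _ => ?_
    split_ifs with hm
    · rw [hz m (by omega), mul_zero]
    · rfl

theorem ofPowerSums_surjective [CharZero K] : Function.Surjective (ofPowerSums K) := by
  intro F
  obtain ⟨d, hd⟩ := F.2.1
  set q := MvPowerSeries.truncTotal (d + 1) (restrict K d F) with hq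
  have hcq : (q : MvPowerSeries (Fin d) K) = restrict K d F := by
    ext β
    rw [MvPolynomial.coeff_coe, hq, MvPowerSeries.coeff_truncTotal_eq_ite]
    split_ifs with hβ
    · rfl
    · by_contra hne
      rw [coeff_restrict] at hne
      have := hd _ (Ne.symm hne)
      rw [Finsupp.degree_apply, Finsupp.support_embDomain, Finset.sum_map] at this
      simp only [Finsupp.embDomain_apply_self] at this
      rw [Finsupp.degree_apply] at hβ
      omega
  have hsym : q.IsSymmetric := by
    intro σ
    ext γ
    obtain ⟨β, rfl⟩ : ∃ β, Finsupp.mapDomain σ β = γ :=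
      ⟨Finsupp.mapDomain σ.symm γ, by rw [← Finsupp.mapDomain_comp]; simp⟩
    rw [MvPolynomial.coeff_rename_mapDomain _ σ.injective, ← MvPolynomial.coeff_coe,
      ← MvPolynomial.coeff_coe, hcq, coeff_restrict, coeff_restrict]
    have h1 := F.2.2 (σ.viaEmbedding Fin.valEmbedding)
    have h2 : (Finsupp.mapDomain σ β).embDomain Fin.valEmbedding =
        (β.embDomain Fin.valEmbedding).embDomain
          (σ.viaEmbedding Fin.valEmbedding).toEmbedding := by
      simp only [Finsupp.embDomain_eq_mapDomain, ← Finsupp.mapDomain_comp]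
      congr 1
      funext i
      exact (Equiv.Perm.viaEmbedding_apply σ Fin.valEmbedding i).symm
    rw [h2]
    conv_rhs => rw [← h1]
    exact (MvPowerSeries.coeff_embDomain_rename
      (σ.viaEmbedding Fin.valEmbedding).toEmbedding _ _).symm
  obtain ⟨g, hg⟩ := exists_aeval_psum_eq K d q hsym
  obtain ⟨t, ht⟩ := exists_trunc K (MvPolynomial.rename (fun i : Fin d => Nat.succPNat i) g) d
  have hdeg : ∀ β : Fin d →₀ ℕ, (β.embDomain Fin.valEmbedding).degree = β.degree := by
    intro β
    rw [Finsupp.degree_apply, Finsupp.degree_apply, Finsupp.support_embDomain, Finset.sum_map]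
    exact Finset.sum_congr rfl fun i _ => Finsupp.embDomain_apply_self _ _ _
  refine ⟨t, ?_⟩
  rw [← sub_eq_zero]
  apply eq_zero_of_restrict K d
  · intro α hα
    by_contra hc
    apply hα
    rw [AddSubgroupClass.coe_sub, map_sub, ht, if_neg hc, not_not.1 (mt (hd α) hc), sub_zero]
  · ext β
    rw [coeff_restrict, AddSubgroupClass.coe_sub, map_sub, ht, hdeg, ← coeff_restrict,
      ← coeff_restrict, restrict_ofPowerSums, hg, hcq, map_zero]
    split_ifs with hβ
    · rw [sub_self]
    · rw [zero_sub, neg_eq_zero, coeff_restrict]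
      refine not_not.1 (mt (hd _) ?_)
      rwa [hdeg]

/-- In characteristic zero the power sums `p₁, p₂, …` are algebraically independent and generate the
ring of symmetric functions. -/
noncomputable def powerSumEquiv [CharZero K] : MvPolynomial ℕ+ K ≃ₐ[K] SymFun K :=
  AlgEquiv.ofBijective (ofPowerSums K) ⟨ofPowerSums_injective K, ofPowerSums_surjective K⟩

end SymFun

namespace SymFun

variable (K : Type*) [Field K]

/-- The evaluation `F(a₁, …, aₙ, 0, 0, …)`; only finitely many terms of the sum are nonzero,
because `F` has bounded degree. -/
noncomputable def evalAt {K : Type*} [Field K] {n : ℕ} (a : Fin n → K) (F : SymFun K) : K :=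
  ∑ᶠ β : Fin n →₀ ℕ,
    MvPowerSeries.coeff (β.embDomain Fin.valEmbedding) (F : MvPowerSeries ℕ K) *
      ∏ i, a i ^ β i

/-- `z_λ = ∏ i ^ mᵢ * mᵢ!` for the partition `λ` with `mᵢ` parts equal to `i`. -/
def zee (m : ℕ+ →₀ ℕ) : ℕ :=
  m.prod fun i mi => (i : ℕ) ^ mi * mi.factorial

variable [CharZero K]

/-- The scalar product of symmetric functions (the Hall inner product): the `K`-bilinear form with
`⟨p_λ, p_μ⟩ = z_λ` if `λ = μ` and `0` otherwise, where `p_λ` runs over the monomials in the power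
sums. -/
noncomputable def scalar : SymFun K →ₗ[K] SymFun K →ₗ[K] K :=
  ((MvPolynomial.basisMonomials ℕ+ K).constr K
    fun m => (zee m : K) • MvPolynomial.lcoeff K m).compl₁₂
      (powerSumEquiv K).symm.toLinearMap (powerSumEquiv K).symm.toLinearMap

/-- The plethysm `f[a]` of a symmetric function `f` with an element `a` of a commutative
`K`-algebra `A` on which the plethysms `p_n[·]` with the power sums are the algebra homomorphisms
`ψ n`: the map `f ↦ f[a]` is the algebra homomorphism with `p_n[a] = ψ n a`. -/
noncomputable def plethysm {K : Type*} [Field K] [CharZero K] {A : Type*} [CommRing A]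
    [Algebra K A] (ψ : ℕ+ → A →ₐ[K] A) (f : SymFun K) (a : A) : A :=
  MvPolynomial.aeval (fun n => ψ n a) ((powerSumEquiv K).symm f)

/-- The plethysm `g ↦ p_n[g]` on symmetric functions in one alphabet: the algebra homomorphism
with `p_n[p_m] = p_{mn}` (it replaces every variable by its `n`-th power). -/
noncomputable def adams (n : ℕ+) : SymFun K →ₐ[K] SymFun K :=
  (MvPolynomial.aeval fun m : ℕ+ => p K (m * n)).comp
    ((powerSumEquiv K).symm : SymFun K →ₐ[K] MvPolynomial ℕ+ K)

open scoped TensorProduct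

/-- Symmetric functions in two distinct alphabets `X` (first factor) and `Y` (second factor). -/
abbrev TwoAlphabets : Type _ := SymFun K ⊗[K] SymFun K

/-- The plethysm `p_n[·]` on symmetric functions in the two alphabets `X` and `Y`. -/
noncomputable def adamsXY (n : ℕ+) : TwoAlphabets K →ₐ[K] TwoAlphabets K :=
  Algebra.TensorProduct.map (adams K n) (adams K n)

variable {K}

/-- The symmetric function `f[X]`, as a function of both alphabets. -/
noncomputable def inX (f : SymFun K) : TwoAlphabets K := f ⊗ₜ[K] 1

/-- The symmetric function `f[Y]`, as a function of both alphabets. -/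
noncomputable def inY (f : SymFun K) : TwoAlphabets K := 1 ⊗ₜ[K] f

/-- `⟨Φ, g[Y]⟩_Y`: the scalar product taken in the alphabet `Y` only; it is `K`-linear in `Φ` and
`⟨f[X] * g'[Y], g[Y]⟩_Y = ⟨g', g⟩ f`. -/
noncomputable def scalarY (Φ : TwoAlphabets K) (g : SymFun K) : SymFun K :=
  TensorProduct.rid K (SymFun K) (((scalar K).flip g).lTensor (SymFun K) Φ)

end SymFun

universe u w

open CategoryTheory

/-- A functor `P` on finite-dimensional vector spaces is a homogeneous polynomial functor of degree
`k` if all its maps `Hom(U, V) → Hom(P(U), P(V))` are homogeneous polynomial maps of degree `k`: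
for all `f₁, …, fₙ : U ⟶ V`, `P(t₁ f₁ + ⋯ + tₙ fₙ)` is a homogeneous polynomial of degree `k` in
the scalars `t₁, …, tₙ` with coefficients in `Hom(P(U), P(V))`. -/
def IsHomogeneousPolynomialFunctor {K : Type u} [Field K]
    (P : FGModuleCat.{u} K ⥤ FGModuleCat.{u} K) (k : ℕ) : Prop :=
  ∀ (U V : FGModuleCat.{u} K) (n : ℕ) (f : Fin n → (U ⟶ V)),
    ∃ c : (Fin n →₀ ℕ) →₀ (P.obj U ⟶ P.obj V), (∀ α ∈ c.support, α.degree = k) ∧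
      ∀ t : Fin n → K, P.map (∑ i, t i • f i) = c.sum fun α m => (∏ i, t i ^ α i) • m

/-- `F` is the character of the functor `P`: `F(a₁, …, aₙ, 0, 0, …) = tr P(A)` for every invertible
diagonal matrix `A` with diagonal entries `a₁, …, aₙ`. -/
def IsCharacter {K : Type u} [Field K]
    (P : FGModuleCat.{u} K ⥤ FGModuleCat.{u} K) (F : SymFun K) : Prop :=
  ∀ (n : ℕ) (a : Fin n → K), (∀ i, a i ≠ 0) →
    SymFun.evalAt a F = LinearMap.trace K (P.obj (FGModuleCat.of K (Fin n → K)))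
      (P.map (FGModuleCat.ofHom (Matrix.toLin' (Matrix.diagonal a)))).hom.hom

/-- The representation `P(V)` of `G` obtained by applying the functor `P` to the representation
`V`. -/
noncomputable def mapRep {K : Type u} [Field K] {G : Type w} [Group G]
    (P : FGModuleCat.{u} K ⥤ FGModuleCat.{u} K) {V : FGModuleCat.{u} K}
    (ρ : Representation K G V) : Representation K G (P.obj V) where
  toFun g := (P.map (FGModuleCat.ofHom (ρ g) : V ⟶ V)).hom.hom
  map_one' := by
    have : (FGModuleCat.ofHom (ρ 1) : V ⟶ V) = 𝟙 V := by rw [map_one]; rfl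
    rw [this, P.map_id]; rfl
  map_mul' g g' := by
    have : (FGModuleCat.ofHom (ρ (g * g')) : V ⟶ V) =
        (FGModuleCat.ofHom (ρ g') : V ⟶ V) ≫ (FGModuleCat.ofHom (ρ g) : V ⟶ V) := by
      rw [map_mul]; rfl
    rw [this, P.map_comp]; rfl

section TensorInvariants

open scoped TensorProduct

variable {K : Type*} [Field K] {G : Type*} [Group G] {V : Type*} [AddCommGroup V] [Module K V]

/-- The diagonal action of `G` on the `r`-th tensor power of `V`. -/
noncomputable def tensorPowerRep (ρ : Representation K G V) (r : ℕ) :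
    Representation K G (⨂[K] _ : Fin r, V) where
  toFun g := PiTensorProduct.map fun _ => ρ g
  map_one' := by
    simp only [map_one]
    exact PiTensorProduct.map_one
  map_mul' g g' := by
    simp only [map_mul]
    exact PiTensorProduct.map_mul _ _

/-- The action of a permutation on the `G`-invariant subspace of the `r`-th tensor power of `V`, by
permuting the tensor factors. -/
noncomputable def permInvariants (ρ : Representation K G V) (r : ℕ) (π : Equiv.Perm (Fin r)) :
    (tensorPowerRep ρ r).invariants →ₗ[K] (tensorPowerRep ρ r).invariants :=
  (PiTensorProduct.reindex K (fun _ : Fin r => V) π).toLinearMap.restrict fun x hx g => by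
    have h := PiTensorProduct.map_reindex (fun _ : Fin r => ρ g) π x
    exact h.trans (congrArg _ (hx g))

/-- `I_r(V)`: the Frobenius character `(1 / r!) ∑ π, tr(π) p_{λ(π)}`, with `λ(π)` the cycle type
of `π`, of the action of the symmetric group on the `G`-invariants of the `r`-th tensor power. -/
noncomputable def invariantCharacter (ρ : Representation K G V) (r : ℕ) : SymFun K :=
  (r.factorial : K)⁻¹ • ∑ π : Equiv.Perm (Fin r),
    LinearMap.trace K _ (permInvariants ρ r π) •
      (π.partition.parts.map fun i => SymFun.p K i).prod

end TensorInvariants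

/-! In characteristic 0 a homogeneous polynomial functor `Q` of degree `n` is a natural direct
summand of finitely many copies of `V ↦ V^{⊗n}`. Polarizing `Q` gives natural maps `fromTensor` and
`toTensor` between `V^{⊗n}` and `Q(V)`, one for each element of, respectively each functional on,
`Q(K^n)`; summed over a basis of `Q(K^n)` and its dual, their composites give the identity of `Q(V)`
(`sum_fromTensor_comp_toTensor`). If `θ` is a natural endomorphism of `Q`, the opposite composite
with `θ` in the middle is a combination of permutations of the tensor factors, with coefficients
that do not depend on `V` (`toTensor_comp_fromTensor`).

Cyclicity of the trace then yields two formulas with the same coefficients `c_σ`: `tr(θ ∘ Q(f)) = ∑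
c_σ tr(σ ∘ f^{⊗n})` (`trace_comp_lmap`), and `tr(θ | Q(V)^G) = ∑ c_σ tr(σ | (V^{⊗n})^G)`
(`trace_restrict_invariants`).

Take `Q = P^{⊗r}`, `n = rk` and let `θ` be a permutation `π` of the `r` factors. For diagonal `f`
the first formula says that `∏ p_l[ch P]`, over the cycle lengths `l` of `π`, equals `∑ c_σ
p_{λ(σ)}` (`IsCharacter.prod_adams`). Pairing `p_{λ(σ)}` with `I_{rk}(V)` extracts the trace of `σ`
on the invariants, so the second formula turns the pairing of that product with `I_{rk}(V)` into the
trace of `π` on `(P(V)^{⊗r})^G`. Averaging over `π` against `p_{λ(π)}[X]` gives the theorem, by the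
power sum expansion of `h_r`. The first formula with `Q = P` and `θ = id` also provides the
character itself. -/

/-! ### Sums over words attached to a permutation, and cycle types. -/

namespace Equiv.Perm

open _root_.Finset

variable {α κ R : Type*} [Fintype α] [DecidableEq α] [Fintype κ] [CommRing R]

/-- The trace of the composite of a permutation of tensor factors with the tensor power of `M`. -/
def cycleSum (M : Matrix κ κ R) (σ : Perm α) : R :=
  ∑ w : α → κ, ∏ i, M (w i) (w (σ i))

/-- A word on `α` is a pair of words, one on `p` and one on its complement, and no factor `M (w i)
(w (σ i))` mixes the two. -/
theorem cycleSum_eq_mul (M : Matrix κ κ R) (σ : Perm α) (p : α → Prop) [DecidablePred p]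
    (hp : ∀ x, p (σ x) ↔ p x) :
    cycleSum M σ = cycleSum M (σ.subtypePerm hp) *
      cycleSum M (σ.subtypePerm (p := fun x => ¬ p x) fun x => not_congr (hp x)) := by
  unfold cycleSum
  rw [sum_mul_sum, ← Fintype.sum_prod_type',
    ← (Equiv.piEquivPiSubtypeProd p (fun _ => κ)).sum_comp]
  refine sum_congr rfl fun w _ => ?_
  rw [← Fintype.prod_subtype_mul_prod_subtype p]
  rfl

theorem cycleSum_conj {β : Type*} [Fintype β] [DecidableEq β] (M : Matrix κ κ R) (e : α ≃ β)
    (σ : Perm α) (τ : Perm β) (h : ∀ x, e (σ x) = τ (e x)) : cycleSum M σ = cycleSum M τ := by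
  unfold cycleSum
  rw [← (e.arrowCongr (Equiv.refl κ)).sum_comp]
  refine sum_congr rfl fun w _ => ?_
  rw [← e.prod_comp]
  simp [← h]

theorem cycleType_eq_add_subtypePerm (σ : Perm α) (p : α → Prop) [DecidablePred p]
    (hp : ∀ x, p (σ x) ↔ p x) :
    σ.cycleType = (σ.subtypePerm hp).cycleType +
      (σ.subtypePerm (p := fun x => ¬ p x) fun x => not_congr (hp x)).cycleType := by
  have hd : Disjoint (ofSubtype (σ.subtypePerm hp))
      (ofSubtype (σ.subtypePerm (p := fun x => ¬ p x) fun x => not_congr (hp x))) := by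
    intro x
    by_cases h : p x
    · exact Or.inr (ofSubtype_apply_of_not_mem _ (not_not.2 h))
    · exact Or.inl (ofSubtype_apply_of_not_mem _ h)
  rw [← cycleType_ofSubtype (g := σ.subtypePerm hp),
    ← cycleType_ofSubtype (p := fun x => ¬ p x), ← hd.cycleType_mul]
  congr 1
  ext x
  rw [mul_apply]
  by_cases h : p x
  · rw [ofSubtype_apply_of_not_mem (p := fun x => ¬ p x) _ (not_not.2 h),
      ofSubtype_apply_of_mem _ h]
    rfl
  · rw [ofSubtype_apply_of_mem (p := fun x => ¬ p x) _ h,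
      ofSubtype_apply_of_not_mem]
    · rfl
    · rw [subtypePerm_apply]
      exact mt (hp x).1 h

theorem parts_partition_eq_add_subtypePerm (σ : Perm α) (p : α → Prop) [DecidablePred p]
    (hp : ∀ x, p (σ x) ↔ p x) :
    σ.partition.parts = (σ.subtypePerm hp).partition.parts +
      (σ.subtypePerm (p := fun x => ¬ p x) fun x => not_congr (hp x)).partition.parts := by
  have h := cycleType_eq_add_subtypePerm σ p hp
  -- The number of fixed points is a truncated subtraction; these bounds make it additive over the
  -- two blocks.
  have h1 := card_le_univ (σ.subtypePerm hp).support
  have h2 := card_le_univ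
    (σ.subtypePerm (p := fun x => ¬ p x) fun x => not_congr (hp x)).support
  have h3 := Fintype.card_subtype_compl p
  have h5 := Fintype.card_subtype_le p
  have h4 := congrArg Multiset.sum h
  rw [Multiset.sum_add, sum_cycleType, sum_cycleType, sum_cycleType] at h4
  rw [parts_partition, parts_partition, parts_partition, h, add_add_add_comm,
    ← Multiset.replicate_add]
  congr 2
  omega

variable [DecidableEq κ]

/-- The sum runs over paths from `a` to `b` with intermediate vertices `w`: `Fin.cons` lists the
sources of the steps and `Fin.snoc` their targets. -/
theorem matrix_pow_succ_apply (M : Matrix κ κ R) (n : ℕ) (a b : κ) :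
    (M ^ (n + 1)) a b = ∑ w : Fin n → κ, ∏ i : Fin (n + 1),
      M (Fin.cons (α := fun _ => κ) a w i) (Fin.snoc (α := fun _ => κ) w b i) := by
  induction n generalizing a with
  | zero =>
    have : (Fin.snoc (α := fun _ => κ) default b 0 : κ) = b := Fin.snoc_last (n := 0) (α := fun _ => κ) b default
    simp [this]
  | succ n ih =>
    rw [pow_succ', Matrix.mul_apply, ← (Fin.consEquiv fun _ : Fin (n + 1) => κ).sum_comp,
      Fintype.sum_prod_type]
    refine sum_congr rfl fun c _ => ?_
    rw [ih, mul_sum]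
    refine sum_congr rfl fun w _ => ?_
    have h : (Fin.consEquiv fun _ : Fin (n + 1) => κ) (c, w) = Fin.cons c w := rfl
    rw [h, Fin.prod_univ_succ (n := n + 1), ← Fin.cons_snoc_eq_snoc_cons]
    simp only [Fin.cons_zero, Fin.cons_succ]

theorem cycleSum_finRotate (M : Matrix κ κ R) (n : ℕ) :
    cycleSum M (finRotate (n + 1)) = (M ^ (n + 1)).trace := by
  unfold cycleSum Matrix.trace
  rw [← (Fin.consEquiv fun _ : Fin (n + 1) => κ).sum_comp, Fintype.sum_prod_type]
  refine sum_congr rfl fun a _ => ?_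
  rw [Matrix.diag_apply, matrix_pow_succ_apply]
  refine sum_congr rfl fun w _ => ?_
  refine prod_congr rfl fun i _ => ?_
  -- On a closed path the list of targets is the list of sources rotated by one step.
  rw [Fin.snoc_eq_cons_rotate]
  rfl

theorem cycleSum_of_sameCycle [Nonempty α] (M : Matrix κ κ R) (σ : Perm α)
    (h : ∀ x y, σ.SameCycle x y) : cycleSum M σ = (M ^ Fintype.card α).trace := by
  obtain ⟨a⟩ := ‹Nonempty α›
  have hc : σ.IsCycleOn (univ : Finset α) := ⟨by simp, fun x _ y _ => h x y⟩
  obtain ⟨n, hn⟩ : ∃ n, Fintype.card α = n + 1 :=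
    Nat.exists_eq_succ_of_ne_zero (Fintype.card_pos_iff.2 ⟨a⟩).ne'
  -- Listing the single orbit as `a, σ a, σ² a, …` conjugates `σ` to `finRotate`.
  have hb : Function.Bijective fun i : Fin (n + 1) => (σ ^ (i : ℕ)) a := by
    rw [Fintype.bijective_iff_surjective_and_card, Fintype.card_fin, hn]
    refine ⟨fun y => ?_, rfl⟩
    obtain ⟨m, hm, rfl⟩ := hc.exists_pow_eq (mem_univ a) (mem_univ y)
    rw [card_univ, hn] at hm
    exact ⟨⟨m, hm⟩, rfl⟩
  rw [hn, ← cycleSum_finRotate]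
  refine (cycleSum_conj M (Equiv.ofBijective _ hb) _ _ fun i => ?_).symm
  simp only [ofBijective_apply]
  rw [← mul_apply, ← pow_succ', coe_finRotate]
  split_ifs with hi
  · rw [hi, Fin.val_last, ← hn, pow_zero, one_apply, ← card_univ, hc.pow_card_apply (mem_univ a)]
  · rfl

theorem parts_partition_of_sameCycle [Nonempty α] (σ : Perm α)
    (h : ∀ x y, σ.SameCycle x y) : σ.partition.parts = {Fintype.card α} := by
  rw [parts_partition]
  obtain ⟨a⟩ := ‹Nonempty α›
  -- `cycleType` leaves out cycles of length one, so the one-point orbit is treated apart.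
  by_cases ha : σ a = a
  · have : Subsingleton α := by
      refine subsingleton_of_forall_eq a fun y => ?_
      obtain ⟨i, rfl⟩ := h a y
      exact zpow_apply_eq_self_of_apply_eq_self ha i
    rw [Subsingleton.elim σ 1, cycleType_one, support_one, card_empty,
      Fintype.card_eq_one_iff.2 ⟨a, fun y => Subsingleton.elim _ _⟩]
    rfl
  · have hs : σ.support = univ := by
      ext y
      simpa using (h a y).apply_eq_self_iff.not.1 ha
    have hc : σ.IsCycle := ⟨a, ha, fun y _ => h a y⟩
    rw [hc.cycleType, hs, card_univ, Nat.sub_self, Multiset.replicate_zero, add_zero]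

/-- The cycle of a chosen point splits off as one factor, and induction on the cardinality handles
the rest. -/
theorem cycleSum_eq_prod (M : Matrix κ κ R) (σ : Perm α) :
    cycleSum M σ = (σ.partition.parts.map fun l => (M ^ l).trace).prod := by
  obtain ⟨n, hn⟩ : ∃ n, Fintype.card α = n := ⟨_, rfl⟩
  induction n using Nat.strong_induction_on generalizing α with
  | _ n ih =>
    rcases isEmpty_or_nonempty α with hα | hα
    · have : σ.partition.parts = 0 := by
        rw [parts_partition, Subsingleton.elim σ 1, cycleType_one, Fintype.card_of_isEmpty]
        simp
      rw [this]
      simp [cycleSum]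
    · obtain ⟨a⟩ := id hα
      have hp : ∀ x, σ.SameCycle a (σ x) ↔ σ.SameCycle a x := fun x => sameCycle_apply_right
      have : Nonempty {x // σ.SameCycle a x} := ⟨⟨a, SameCycle.refl _ _⟩⟩
      have h : ∀ x y, (σ.subtypePerm hp).SameCycle x y := fun x y => by
        rw [sameCycle_subtypePerm]
        exact x.2.symm.trans y.2
      have hlt : Fintype.card {x // ¬ σ.SameCycle a x} < n := by
        rw [← hn]
        exact Fintype.card_subtype_lt (x := a) (not_not.2 (SameCycle.refl _ _))
      rw [cycleSum_eq_mul M σ _ hp, parts_partition_eq_add_subtypePerm σ _ hp,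
        parts_partition_of_sameCycle _ h, cycleSum_of_sameCycle M _ h, ih _ hlt _ rfl,
        Multiset.map_add, Multiset.prod_add, Multiset.map_singleton, Multiset.prod_singleton]

theorem parts_partition_inv (σ : Perm α) : σ⁻¹.partition.parts = σ.partition.parts := by
  rw [parts_partition, parts_partition, cycleType_inv, support_inv]

end Equiv.Perm

/-! ### Traces on tensor powers. -/

section TensorTrace

open scoped TensorProduct

variable {K : Type*} [Field K] {V : Type*} [AddCommGroup V] [Module K V] [Module.Finite K V]

/-- The trace of a permutation of tensor factors composed with the tensor power of a map. -/
theorem trace_reindex_comp_map (n : ℕ) (σ : Equiv.Perm (Fin n)) (f : V →ₗ[K] V) :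
    LinearMap.trace K _ ((PiTensorProduct.reindex K (fun _ : Fin n => V) σ).toLinearMap ∘ₗ
        PiTensorProduct.map fun _ => f) =
      (σ.partition.parts.map fun l => LinearMap.trace K V (f ^ l)).prod := by
  classical
  let b := Module.finBasis K V
  -- Position `i` of the permuted tensor holds the old factor `σ⁻¹ i`, so the diagonal entries
  -- produce the cycle sum of `σ⁻¹`, which has the same cycle lengths as `σ`.
  have h := Equiv.Perm.cycleSum_eq_prod (LinearMap.toMatrix b b f) σ⁻¹
  rw [Equiv.Perm.parts_partition_inv] at h
  have h2 : ∀ l, (LinearMap.toMatrix b b f ^ l).trace = LinearMap.trace K V (f ^ l) := fun l => by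
    rw [LinearMap.toMatrix_pow, LinearMap.trace_eq_matrix_trace K b]
  simp only [h2] at h
  rw [← h, LinearMap.trace_eq_matrix_trace K (Basis.piTensorProduct fun _ : Fin n => b)]
  unfold Matrix.trace Equiv.Perm.cycleSum
  refine Finset.sum_congr rfl fun w _ => ?_
  rw [Matrix.diag_apply, LinearMap.toMatrix_apply, LinearMap.comp_apply,
    Basis.piTensorProduct_apply, PiTensorProduct.map_tprod]
  erw [PiTensorProduct.reindex_tprod, Basis.piTensorProduct_repr_tprod_apply]
  refine Finset.prod_congr rfl fun i _ => ?_
  rw [LinearMap.toMatrix_apply]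
  rfl

end TensorTrace

/-! ### Polarization of multilinear maps. -/

section Polarization

theorem LinearMap.comp_finsetSum {R M N P ι : Type*} [CommSemiring R] [AddCommMonoid M]
    [AddCommMonoid N] [AddCommMonoid P] [Module R M] [Module R N] [Module R P]
    (g : N →ₗ[R] P) (s : Finset ι) (f : ι → (M →ₗ[R] N)) :
    g ∘ₗ ∑ i ∈ s, f i = ∑ i ∈ s, g ∘ₗ f i :=
  map_sum (g.compRight R (M := M)) f s

theorem LinearMap.finsetSum_comp {R M N P ι : Type*} [CommSemiring R] [AddCommMonoid M]
    [AddCommMonoid N] [AddCommMonoid P] [Module R M] [Module R N] [Module R P]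
    (g : M →ₗ[R] N) (s : Finset ι) (f : ι → (N →ₗ[R] P)) :
    (∑ i ∈ s, f i) ∘ₗ g = ∑ i ∈ s, f i ∘ₗ g :=
  map_sum (g.lcomp R P) f s

variable {K M N : Type*} [Field K] [AddCommGroup M] [Module K M] [AddCommGroup N] [Module K N]
  {ι : Type*} [Fintype ι] [DecidableEq ι]

/-- The polarization identity: inclusion-exclusion applied to the diagonal of a multilinear map
gives its symmetrization. -/
theorem MultilinearMap.sum_neg_one_pow_smul_diagonal (μ : MultilinearMap K (fun _ : ι => M) N)
    (f : ι → M) :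
    ∑ T : Finset ι, (-1 : K) ^ T.card • μ (fun _ => ∑ i ∈ Tᶜ, f i) =
      ∑ σ : Equiv.Perm ι, μ fun i => f (σ i) := by
  have h1 : ∀ T : Finset ι, (-1 : K) ^ T.card • μ (fun _ => ∑ i ∈ Tᶜ, f i) =
      ∑ r : ι → ι, if T ⊆ (Finset.univ.image r)ᶜ then (-1 : K) ^ T.card • μ (fun i => f (r i))
        else 0 := by
    intro T
    rw [MultilinearMap.map_sum_finset, Finset.smul_sum, ← Finset.sum_filter]
    refine Finset.sum_congr ?_ fun _ _ => rfl
    ext r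
    simp only [Fintype.mem_piFinset, Finset.mem_compl, Finset.mem_filter, Finset.mem_univ,
      true_and, Finset.subset_iff, Finset.mem_image, not_exists]
    exact ⟨fun h x hx i hi => h i (hi ▸ hx), fun h i hi => h hi i rfl⟩
  simp only [h1]
  rw [Finset.sum_comm]
  -- A fixed word `r` occurs for exactly those `T` that avoid its image; their signs cancel unless
  -- the image is everything.
  have h2 : ∀ r : ι → ι, (∑ T : Finset ι, if T ⊆ (Finset.univ.image r)ᶜ then
      (-1 : K) ^ T.card • μ (fun i => f (r i)) else 0) =
      if Function.Surjective r then μ (fun i => f (r i)) else 0 := by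
    intro r
    rw [← Finset.sum_filter]
    have : (Finset.univ.filter fun T => T ⊆ (Finset.univ.image r)ᶜ) =
        ((Finset.univ.image r)ᶜ).powerset := by
      ext T; simp
    rw [this, ← Finset.sum_smul]
    have h3 := congrArg (Int.cast : ℤ → K)
      (Finset.sum_powerset_neg_one_pow_card (x := (Finset.univ.image r)ᶜ))
    push_cast at h3
    rw [h3]
    have h4 : (Finset.univ.image r)ᶜ = ∅ ↔ Function.Surjective r := by
      simp [Finset.compl_eq_empty_iff, Finset.eq_univ_iff_forall, Function.Surjective]
    simp only [h4]
    split_ifs <;> simp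
  simp only [h2]
  rw [← Finset.sum_filter]
  symm
  refine Finset.sum_bij (fun σ _ => σ) (fun σ _ => ?_) (fun σ _ τ _ h => ?_) (fun r hr => ?_)
    fun _ _ => rfl
  · simpa using σ.surjective
  · exact DFunLike.coe_injective h
  · rw [Finset.mem_filter] at hr
    exact ⟨Equiv.ofBijective r (Finite.injective_iff_bijective.1
      (Finite.injective_iff_surjective.2 hr.2)), Finset.mem_univ _, rfl⟩

end Polarization

/-! ### Polarization of a homogeneous polynomial functor. -/

namespace FGModuleCat

variable {K : Type u} [Field K] (Q : FGModuleCat.{u} K ⥤ FGModuleCat.{u} K)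

/-- The action of a functor on linear maps. -/
noncomputable def lmap {U W : FGModuleCat.{u} K} (f : U →ₗ[K] W) : Q.obj U →ₗ[K] Q.obj W :=
  (Q.map (FGModuleCat.ofHom f)).hom.hom

theorem lmap_id (U : FGModuleCat.{u} K) : lmap Q (LinearMap.id : U →ₗ[K] U) = LinearMap.id := by
  have : (FGModuleCat.ofHom (LinearMap.id : U →ₗ[K] U)) = 𝟙 U := rfl
  rw [lmap, this, Q.map_id]
  rfl

theorem lmap_comp {U W X : FGModuleCat.{u} K} (g : W →ₗ[K] X) (f : U →ₗ[K] W) :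
    lmap Q (g ∘ₗ f) = lmap Q g ∘ₗ lmap Q f := by
  have : (FGModuleCat.ofHom (g ∘ₗ f) : U ⟶ X) = FGModuleCat.ofHom f ≫ FGModuleCat.ofHom g := rfl
  rw [lmap, this, Q.map_comp]
  rfl

/-- Passing from morphisms to linear maps, as a linear map. -/
noncomputable def homLinear (U W : FGModuleCat.{u} K) : (U ⟶ W) →ₗ[K] (U →ₗ[K] W) where
  toFun f := f.hom.hom
  map_add' _ _ := rfl
  map_smul' _ _ := rfl

/-- Writing a degree `n` monomial as a product of exactly `n` variables makes it the diagonal of an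
`n`-linear form. -/
theorem exists_word {m : ℕ} (n : ℕ) (α : Fin m →₀ ℕ) (hα : α.degree = n) :
    ∃ w : Fin n → Fin m, ∀ t : Fin m → K, ∏ i, t i ^ α i = ∏ j, t (w j) := by
  have hl : (Finsupp.toMultiset α).toList.length = n := by
    rw [Multiset.length_toList, Finsupp.card_toMultiset, ← hα]
    rfl
  subst hl
  refine ⟨fun j => (Finsupp.toMultiset α).toList.get j, fun t => ?_⟩
  refine Eq.trans ?_ (Fin.prod_univ_fun_getElem _ t).symm
  rw [← Multiset.prod_coe, ← Multiset.map_coe, Multiset.coe_toList, Finsupp.toMultiset_map,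
    Finsupp.prod_toMultiset, Finsupp.prod_mapDomain_index (fun _ => pow_zero _)
      (fun _ _ _ => pow_add _ _ _), Finsupp.prod_fintype _ _ fun _ => pow_zero _]

variable {Q} in
theorem exists_multilinear {n : ℕ} (hQ : IsHomogeneousPolynomialFunctor Q n)
    (U W : FGModuleCat.{u} K) :
    ∃ μ : MultilinearMap K (fun _ : Fin n => U →ₗ[K] W) (Q.obj U →ₗ[K] Q.obj W),
      ∀ f, lmap Q f = μ fun _ => f := by
  let b := Module.finBasis K (U →ₗ[K] W)
  obtain ⟨c, hc, h⟩ := hQ U W _ fun i => FGModuleCat.ofHom (b i)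
  choose w hw using fun α : c.support => exists_word (K := K) n α.1 (hc α.1 α.2)
  refine ⟨∑ α : c.support, ((MultilinearMap.mkPiAlgebra K (Fin n) K).compLinearMap
    fun j => b.coord (w α j)).smulRight (homLinear _ _ (c α)), fun f => ?_⟩
  have h1 := congrArg (homLinear _ _) (h fun i => b.repr f i)
  have h2 : ∑ i, b.repr f i • (FGModuleCat.ofHom (b i) : U ⟶ W) = FGModuleCat.ofHom f := by
    have h3 : homLinear U W (∑ i, b.repr f i • (FGModuleCat.ofHom (b i) : U ⟶ W)) = f := by
      rw [map_sum]
      simp only [map_smul]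
      exact b.sum_repr f
    exact congrArg FGModuleCat.ofHom h3
  rw [h2] at h1
  refine h1.trans ?_
  rw [Finsupp.sum, map_sum, _root_.sum_apply, ← Finset.sum_coe_sort]
  refine Finset.sum_congr rfl fun α _ => ?_
  rw [map_smul, MultilinearMap.smulRight_apply, MultilinearMap.compLinearMap_apply,
    MultilinearMap.mkPiAlgebra_apply, hw]
  rfl

/-- The polarization of the action of a functor on linear maps. -/
noncomputable def polarize {n : ℕ} {U W : FGModuleCat.{u} K} (f : Fin n → (U →ₗ[K] W)) :
    Q.obj U →ₗ[K] Q.obj W :=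
  ∑ T : Finset (Fin n), (-1 : K) ^ T.card • lmap Q (∑ i ∈ Tᶜ, f i)

/-- `polarize` uses only values of `Q` on maps, so this and the next two lemmas need functoriality
or naturality alone, not polynomiality. -/
theorem lmap_comp_polarize {n : ℕ} {U W X : FGModuleCat.{u} K} (g : W →ₗ[K] X)
    (f : Fin n → (U →ₗ[K] W)) :
    lmap Q g ∘ₗ polarize Q f = polarize Q fun i => g ∘ₗ f i := by
  unfold polarize
  rw [LinearMap.comp_finsetSum]
  refine Finset.sum_congr rfl fun T _ => ?_
  rw [LinearMap.comp_smul, ← lmap_comp, LinearMap.comp_finsetSum]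

theorem polarize_comp_lmap {n : ℕ} {U W X : FGModuleCat.{u} K} (f : Fin n → (W →ₗ[K] X))
    (g : U →ₗ[K] W) :
    polarize Q f ∘ₗ lmap Q g = polarize Q fun i => f i ∘ₗ g := by
  unfold polarize
  rw [LinearMap.finsetSum_comp]
  refine Finset.sum_congr rfl fun T _ => ?_
  rw [LinearMap.smul_comp, ← lmap_comp, LinearMap.finsetSum_comp]

theorem comp_polarize {n : ℕ} (θ : ∀ V : FGModuleCat.{u} K, Q.obj V →ₗ[K] Q.obj V)
    (hθ : ∀ (U W : FGModuleCat.{u} K) (f : U →ₗ[K] W), θ W ∘ₗ lmap Q f = lmap Q f ∘ₗ θ U)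
    {U W : FGModuleCat.{u} K} (f : Fin n → (U →ₗ[K] W)) :
    θ W ∘ₗ polarize Q f = polarize Q f ∘ₗ θ U := by
  unfold polarize
  rw [LinearMap.finsetSum_comp, LinearMap.comp_finsetSum]
  refine Finset.sum_congr rfl fun T _ => ?_
  rw [LinearMap.comp_smul, LinearMap.smul_comp, hθ]

variable {Q}

theorem exists_polarize_eq {n : ℕ} (hQ : IsHomogeneousPolynomialFunctor Q n)
    (U W : FGModuleCat.{u} K) :
    ∃ D : MultilinearMap K (fun _ : Fin n => U →ₗ[K] W) (Q.obj U →ₗ[K] Q.obj W),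
      (∀ f, D f = polarize Q f) ∧ ∀ f, (D fun _ => f) = (n.factorial : K) • lmap Q f := by
  obtain ⟨μ, hμ⟩ := exists_multilinear hQ U W
  -- The form `μ` depends on choices, but its symmetrization is `polarize`, which does not.
  refine ⟨∑ σ : Equiv.Perm (Fin n), μ.domDomCongr σ, fun f => ?_, fun f => ?_⟩
  · unfold polarize
    simp only [hμ]
    rw [MultilinearMap.sum_neg_one_pow_smul_diagonal, _root_.sum_apply]
    rfl
  · rw [_root_.sum_apply, hμ]
    simp only [MultilinearMap.domDomCongr_apply]
    rw [Finset.sum_const, Finset.card_univ, Fintype.card_perm, Fintype.card_fin, Nat.cast_smul_eq_nsmul]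

/-- The polarization as a multilinear map. -/
noncomputable def polar {n : ℕ} (hQ : IsHomogeneousPolynomialFunctor Q n)
    (U W : FGModuleCat.{u} K) :
    MultilinearMap K (fun _ : Fin n => U →ₗ[K] W) (Q.obj U →ₗ[K] Q.obj W) :=
  (exists_polarize_eq hQ U W).choose

theorem polar_apply {n : ℕ} (hQ : IsHomogeneousPolynomialFunctor Q n) {U W : FGModuleCat.{u} K}
    (f : Fin n → (U →ₗ[K] W)) : polar hQ U W f = polarize Q f :=
  (exists_polarize_eq hQ U W).choose_spec.1 f

theorem polar_diagonal {n : ℕ} (hQ : IsHomogeneousPolynomialFunctor Q n) {U W : FGModuleCat.{u} K}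
    (f : U →ₗ[K] W) : (polar hQ U W fun _ => f) = (n.factorial : K) • lmap Q f :=
  (exists_polarize_eq hQ U W).choose_spec.2 f

/-- This is the polarization identity in the variables `f` with `g` fixed: on a diagonal `f = (h, …,
h)` the form `polar (h ∘ g i)` is `Q(h) ∘ polar g`, and the signed sum of the `Q(h)` is `polar f`.
-/
theorem polar_comp_polar {n : ℕ} (hQ : IsHomogeneousPolynomialFunctor Q n)
    {U W X : FGModuleCat.{u} K} (f : Fin n → (W →ₗ[K] X)) (g : Fin n → (U →ₗ[K] W)) :
    polar hQ W X f ∘ₗ polar hQ U W g =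
      ∑ σ : Equiv.Perm (Fin n), polar hQ U X fun i => f (σ i) ∘ₗ g i := by
  have h := MultilinearMap.sum_neg_one_pow_smul_diagonal
    ((polar hQ U X).compLinearMap fun i => (g i).lcomp K X) f
  simp only [MultilinearMap.compLinearMap_apply, LinearMap.lcomp_apply'] at h
  rw [← h]
  simp only [polar_apply, ← lmap_comp_polarize]
  rw [polarize, LinearMap.finsetSum_comp]
  refine Finset.sum_congr rfl fun T _ => ?_
  rw [LinearMap.smul_comp]

end FGModuleCat

/-! ### Natural maps between tensor powers and a polynomial functor. -/

section TensorFunctional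

open scoped TensorProduct

variable {K : Type*} [Field K] {V : Type*} [AddCommGroup V] [Module K V]

/-- The linear functional on a tensor power given by a product of functionals. -/
noncomputable def tensorFunctional {n : ℕ} (η : Fin n → (V →ₗ[K] K)) :
    (⨂[K] _ : Fin n, V) →ₗ[K] K :=
  PiTensorProduct.lift ((MultilinearMap.mkPiAlgebra K (Fin n) K).compLinearMap η)

theorem tensorFunctional_tprod {n : ℕ} (η : Fin n → (V →ₗ[K] K)) (v : Fin n → V) :
    tensorFunctional η (PiTensorProduct.tprod K v) = ∏ i, η i (v i) := by
  rw [tensorFunctional, PiTensorProduct.lift.tprod]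
  rfl

theorem tensorFunctional_reindex_tprod {n : ℕ} (η : Fin n → (V →ₗ[K] K)) (v : Fin n → V)
    (σ : Equiv.Perm (Fin n)) :
    tensorFunctional η (PiTensorProduct.reindex K (fun _ : Fin n => V) σ
      (PiTensorProduct.tprod K v)) = ∏ i, η (σ i) (v i) := by
  have h : PiTensorProduct.reindex K (fun _ : Fin n => V) σ (PiTensorProduct.tprod K v) =
      PiTensorProduct.tprod K fun i => v (σ.symm i) := PiTensorProduct.reindex_tprod σ v
  rw [h, tensorFunctional_tprod, ← Equiv.prod_comp σ]
  exact Finset.prod_congr rfl fun i _ => by rw [σ.symm_apply_apply]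

theorem tensorFunctional_map {W : Type*} [AddCommGroup W] [Module K W] {n : ℕ}
    (η : Fin n → (W →ₗ[K] K)) (f : V →ₗ[K] W) (y : ⨂[K] _ : Fin n, V) :
    tensorFunctional η (PiTensorProduct.map (fun _ => f) y) =
      tensorFunctional (fun i => η i ∘ₗ f) y := by
  rw [← LinearMap.comp_apply]
  congr 1
  ext v
  simp [tensorFunctional_tprod]

theorem eq_of_tensorFunctional_eq [Module.Finite K V] {n : ℕ} (y z : ⨂[K] _ : Fin n, V)
    (h : ∀ η, tensorFunctional η y = tensorFunctional η z) : y = z := by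
  let b := Module.finBasis K V
  have h1 : ∀ w : Fin n → _, (Basis.piTensorProduct fun _ : Fin n => b).coord w =
      tensorFunctional fun i => b.coord (w i) := by
    intro w
    ext v
    rw [LinearMap.compMultilinearMap_apply, LinearMap.compMultilinearMap_apply,
      tensorFunctional_tprod, Module.Basis.coord_apply, Basis.piTensorProduct_repr_tprod_apply]
    rfl
  refine (Basis.piTensorProduct fun _ : Fin n => b).ext_elem fun w => ?_
  rw [← Module.Basis.coord_apply, ← Module.Basis.coord_apply, h1, h]

end TensorFunctional

namespace FGModuleCat

open scoped TensorProduct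

variable {K : Type u} [Field K]

/-- The coordinate space `K ^ n`. -/
noncomputable abbrev coordSpace (K : Type u) [Field K] (n : ℕ) : FGModuleCat.{u} K :=
  FGModuleCat.of K (Fin n → K)

/-- The map `x ↦ η x • e_i`. -/
noncomputable def toCoord {n : ℕ} {V : FGModuleCat.{u} K} (i : Fin n) :
    (V →ₗ[K] K) →ₗ[K] (V →ₗ[K] coordSpace K n) :=
  (LinearMap.single K (fun _ : Fin n => K) i).compRight K

/-- The map `t ↦ t_i • v`. -/
noncomputable def ofCoord {n : ℕ} {V : FGModuleCat.{u} K} (i : Fin n) :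
    V →ₗ[K] (coordSpace K n →ₗ[K] V) :=
  LinearMap.smulRightₗ (LinearMap.proj i : (Fin n → K) →ₗ[K] K)

theorem ofCoord_comp_toCoord {n : ℕ} {V W : FGModuleCat.{u} K} (i j : Fin n) (η : V →ₗ[K] K)
    (v : W) : ofCoord i v ∘ₗ toCoord j η = if i = j then η.smulRight v else 0 := by
  refine LinearMap.ext fun y => ?_
  change (Pi.single j (η y) : Fin n → K) i • v = _
  split_ifs with h
  · rw [h, Pi.single_eq_same]
    rfl
  · rw [Pi.single_eq_of_ne h, zero_smul]
    rfl

theorem toCoord_comp_ofCoord {n : ℕ} {V : FGModuleCat.{u} K} (i j : Fin n) (η : V →ₗ[K] K)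
    (v : V) : toCoord (n := n) i η ∘ₗ ofCoord (n := n) j v =
      η v • toCoord (V := coordSpace K n) i (LinearMap.proj j : (Fin n → K) →ₗ[K] K) := by
  refine LinearMap.ext fun (t : Fin n → K) => ?_
  change (Pi.single i (η (t j • v)) : Fin n → K) = η v • (Pi.single i (t j) : Fin n → K)
  rw [map_smul, smul_eq_mul, mul_comm, ← smul_eq_mul, Pi.single_smul]

theorem comp_ofCoord {n : ℕ} {V W : FGModuleCat.{u} K} (i : Fin n) (g : V →ₗ[K] W) (v : V) :
    g ∘ₗ ofCoord (n := n) i v = ofCoord i (g v) :=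
  LinearMap.ext fun (t : Fin n → K) => map_smul g (t i) v

variable {Q : FGModuleCat.{u} K ⥤ FGModuleCat.{u} K} {n : ℕ}
  (hQ : IsHomogeneousPolynomialFunctor Q n)

/-- The natural map from the tensor power to a polynomial functor defined by an element of
`Q(K ^ n)`. -/
noncomputable def fromTensor (m : Q.obj (coordSpace K n)) (V : FGModuleCat.{u} K) :
    (⨂[K] _ : Fin n, V) →ₗ[K] Q.obj V :=
  PiTensorProduct.lift ((LinearMap.applyₗ m).compMultilinearMap
    ((polar hQ (coordSpace K n) V).compLinearMap ofCoord))

theorem fromTensor_tprod (m : Q.obj (coordSpace K n)) (V : FGModuleCat.{u} K) (v : Fin n → V) :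
    fromTensor hQ m V (PiTensorProduct.tprod K v) =
      polar hQ (coordSpace K n) V (fun i => ofCoord i (v i)) m := by
  rw [fromTensor, PiTensorProduct.lift.tprod]
  rfl

/-- The natural map from a polynomial functor to the tensor power defined by a functional on
`Q(K ^ n)`. -/
noncomputable def toTensor (ξ : Q.obj (coordSpace K n) →ₗ[K] K) (V : FGModuleCat.{u} K) :
    Q.obj V →ₗ[K] ⨂[K] _ : Fin n, V :=
  (n.factorial : K)⁻¹ • ∑ w : Fin n → Fin (Module.finrank K V),
    (ξ ∘ₗ polar hQ V (coordSpace K n) fun i => toCoord i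
      ((Module.finBasis K V).coord (w i))).smulRight
        (PiTensorProduct.tprod K fun i => Module.finBasis K V (w i))

theorem toTensor_apply (ξ : Q.obj (coordSpace K n) →ₗ[K] K) (V : FGModuleCat.{u} K)
    (x : Q.obj V) :
    toTensor hQ ξ V x = (n.factorial : K)⁻¹ • ∑ w : Fin n → Fin (Module.finrank K V),
      ξ (polar hQ V (coordSpace K n) (fun i => toCoord i
        ((Module.finBasis K V).coord (w i))) x) •
        (PiTensorProduct.tprod K fun i => Module.finBasis K V (w i)) := by
  rw [toTensor, LinearMap.smul_apply, LinearMap.sum_apply]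
  rfl

/-- This describes `toTensor` without its basis of `V`, which is what makes its naturality visible.
-/
theorem tensorFunctional_toTensor (ξ : Q.obj (coordSpace K n) →ₗ[K] K) (V : FGModuleCat.{u} K)
    (η : Fin n → (V →ₗ[K] K)) (x : Q.obj V) :
    tensorFunctional η (toTensor hQ ξ V x) =
      (n.factorial : K)⁻¹ • ξ (polar hQ V (coordSpace K n) (fun i => toCoord i (η i)) x) := by
  let b := Module.finBasis K V
  have h1 : ∀ i, toCoord i (η i) = ∑ j, (η i (b j)) • toCoord (n := n) i (b.coord j) := by
    intro i
    simp only [← map_smul]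
    rw [← map_sum]
    congr 1
    refine b.ext fun j => ?_
    simp
  rw [toTensor_apply, map_smul, map_sum]
  simp only [h1]
  rw [MultilinearMap.map_sum]
  simp only [MultilinearMap.map_smul_univ]
  rw [LinearMap.sum_apply, map_sum]
  congr 1
  refine Finset.sum_congr rfl fun w _ => ?_
  rw [map_smul, tensorFunctional_tprod, LinearMap.smul_apply, map_smul, smul_eq_mul, smul_eq_mul,
    mul_comm]

theorem toTensor_lmap (ξ : Q.obj (coordSpace K n) →ₗ[K] K) {V W : FGModuleCat.{u} K}
    (g : V →ₗ[K] W) (x : Q.obj V) :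
    toTensor hQ ξ W (lmap Q g x) = PiTensorProduct.map (fun _ => g) (toTensor hQ ξ V x) := by
  refine eq_of_tensorFunctional_eq _ _ fun η => ?_
  rw [tensorFunctional_map, tensorFunctional_toTensor, tensorFunctional_toTensor,
    polar_apply, polar_apply]
  exact congrArg (fun z => (n.factorial : K)⁻¹ • ξ z)
    (LinearMap.congr_fun (polarize_comp_lmap Q (fun i => toCoord i (η i)) g) x)

theorem fromTensor_map (m : Q.obj (coordSpace K n)) {V W : FGModuleCat.{u} K}
    (g : V →ₗ[K] W) (y : ⨂[K] _ : Fin n, V) :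
    fromTensor hQ m W (PiTensorProduct.map (fun _ => g) y) = lmap Q g (fromTensor hQ m V y) := by
  rw [← LinearMap.comp_apply, ← LinearMap.comp_apply]
  congr 1
  ext v
  simp only [LinearMap.compMultilinearMap_apply, LinearMap.comp_apply, PiTensorProduct.map_tprod,
    fromTensor_tprod]
  rw [← LinearMap.comp_apply, polar_apply, polar_apply, lmap_comp_polarize]
  simp only [comp_ofCoord]

variable (θ : ∀ V : FGModuleCat.{u} K, Q.obj V →ₗ[K] Q.obj V)
  (hθ : ∀ (U W : FGModuleCat.{u} K) (f : U →ₗ[K] W), θ W ∘ₗ lmap Q f = lmap Q f ∘ₗ θ U)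

include hθ in
-- Naturality moves `θ` outside the two polarizations. Each composite of coordinate maps is then a
-- scalar `η (σ i) (v i)` times an endomorphism of `K^n`, and multilinearity extracts the scalars:
-- what remains does not involve `V`.
theorem polar_comp_polar_apply (m : Q.obj (coordSpace K n)) (V : FGModuleCat.{u} K)
    (v : Fin n → V) (η : Fin n → (V →ₗ[K] K)) :
    polar hQ V (coordSpace K n) (fun i => toCoord i (η i))
      (θ V (polar hQ (coordSpace K n) V (fun i => ofCoord i (v i)) m)) =
      ∑ σ : Equiv.Perm (Fin n), (∏ i, η (σ i) (v i)) •
        θ _ (polar hQ _ _ (fun i => toCoord (σ i)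
          (LinearMap.proj i : (Fin n → K) →ₗ[K] K)) m) := by
  have h2 := LinearMap.congr_fun (comp_polarize Q θ hθ fun i => toCoord (n := n) i (η i))
    (polar hQ (coordSpace K n) V (fun i => ofCoord i (v i)) m)
  rw [polar_apply]
  refine h2.symm.trans ?_
  rw [LinearMap.comp_apply, ← polar_apply hQ]
  refine (congrArg (θ _) (LinearMap.congr_fun (polar_comp_polar hQ _ _) m)).trans ?_
  rw [LinearMap.sum_apply, map_sum]
  refine Finset.sum_congr rfl fun σ _ => ?_
  simp only [toCoord_comp_ofCoord]
  rw [MultilinearMap.map_smul_univ, LinearMap.smul_apply, map_smul]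

include hθ in
/-- The composite of the natural maps from and to the tensor power is a combination of
permutations of the tensor factors. -/
theorem toTensor_comp_fromTensor (ξ : Q.obj (coordSpace K n) →ₗ[K] K)
    (m : Q.obj (coordSpace K n)) (V : FGModuleCat.{u} K) :
    toTensor hQ ξ V ∘ₗ θ V ∘ₗ fromTensor hQ m V = ∑ σ : Equiv.Perm (Fin n),
      ((n.factorial : K)⁻¹ • ξ (θ _ (polar hQ _ _ (fun i => toCoord (σ i)
        (LinearMap.proj i : (Fin n → K) →ₗ[K] K)) m))) •
        (PiTensorProduct.reindex K (fun _ : Fin n => V) σ).toLinearMap := by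
  refine PiTensorProduct.ext (MultilinearMap.ext fun v => ?_)
  refine eq_of_tensorFunctional_eq _ _ fun η => ?_
  rw [LinearMap.compMultilinearMap_apply, LinearMap.compMultilinearMap_apply,
    LinearMap.comp_apply, LinearMap.comp_apply, tensorFunctional_toTensor, fromTensor_tprod,
    polar_comp_polar_apply hQ θ hθ, map_sum, Finset.smul_sum, LinearMap.sum_apply, map_sum]
  refine Finset.sum_congr rfl fun σ _ => ?_
  -- The product of the `η (σ i) (v i)` is the pairing of `η` with the tensor permuted by `σ`.
  rw [LinearMap.smul_apply, map_smul, map_smul, LinearEquiv.coe_coe,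
    tensorFunctional_reindex_tprod, smul_comm, smul_eq_mul, smul_eq_mul, smul_eq_mul, mul_comm]

/-- A polynomial functor is a natural direct summand of a sum of tensor powers. -/
theorem sum_fromTensor_comp_toTensor [CharZero K] {ι : Type*} [Fintype ι] [DecidableEq ι]
    (e : Module.Basis ι K (Q.obj (coordSpace K n))) (V : FGModuleCat.{u} K) :
    ∑ j, fromTensor hQ (e j) V ∘ₗ toTensor hQ (e.coord j) V = LinearMap.id := by
  have hn : (n.factorial : K) ≠ 0 := Nat.cast_ne_zero.2 n.factorial_ne_zero
  let b := Module.finBasis K V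
  refine LinearMap.ext fun x => ?_
  rw [LinearMap.sum_apply]
  simp only [LinearMap.comp_apply, toTensor_apply, map_smul, map_sum, fromTensor_tprod]
  rw [← Finset.smul_sum, Finset.sum_comm, inv_smul_eq_iff₀ hn]
  -- The sum over `j` recomposes the two polarizations. In the resulting sum over `σ`, `ofCoord (σ
  -- i)` composed with `toCoord i` vanishes unless `σ i = i`, so only `σ = 1` survives.
  have h1 : ∀ w : Fin n → Fin (Module.finrank K V), ∑ j, e.coord j (polar hQ V (coordSpace K n)
      (fun i => toCoord i (b.coord (w i))) x) •
        polar hQ (coordSpace K n) V (fun i => ofCoord i (b (w i))) (e j) =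
      polar hQ V V (fun i => (b.coord (w i)).smulRight (b (w i))) x := by
    intro w
    simp only [← map_smul]
    rw [← map_sum]
    simp only [Module.Basis.coord_apply]
    rw [e.sum_repr, ← LinearMap.comp_apply, polar_comp_polar, LinearMap.sum_apply,
      Finset.sum_eq_single 1]
    · simp only [Equiv.Perm.one_apply, ofCoord_comp_toCoord, if_pos]
    · intro σ _ hσ
      obtain ⟨i, hi⟩ : ∃ i, σ i ≠ i := by
        by_contra hc
        push Not at hc
        exact hσ (Equiv.ext hc)
      rw [MultilinearMap.map_coord_zero _ i, LinearMap.zero_apply]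
      rw [ofCoord_comp_toCoord, if_neg hi]
    · simp
  rw [Finset.sum_congr rfl fun w _ => h1 w, ← LinearMap.sum_apply,
    ← MultilinearMap.map_sum (polar hQ V V) fun _ j => (b.coord j).smulRight (b j)]
  have h2 : ∑ j, (b.coord j).smulRight (b j) = LinearMap.id := by
    refine LinearMap.ext fun y => ?_
    rw [LinearMap.sum_apply]
    exact b.sum_repr y
  -- The sum over all words `w` is the polarization at `(id, …, id)`, that is `n!` times the
  -- identity, which the factor `1 / n!` in `toTensor` compensates.
  rw [h2, polar_diagonal, lmap_id]
  rfl

end FGModuleCat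

/-! ### Traces of natural endomorphisms. -/

namespace FGModuleCat

open scoped TensorProduct

variable {K : Type u} [Field K] {Q : FGModuleCat.{u} K ⥤ FGModuleCat.{u} K} {n : ℕ}
  (hQ : IsHomogeneousPolynomialFunctor Q n)
  (θ : ∀ V : FGModuleCat.{u} K, Q.obj V →ₗ[K] Q.obj V)
  (hθ : ∀ (U W : FGModuleCat.{u} K) (f : U →ₗ[K] W), θ W ∘ₗ lmap Q f = lmap Q f ∘ₗ θ U)

/-- The coefficient of a permutation in the expression of the trace of a natural endomorphism of
a polynomial functor by traces on tensor powers. -/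
noncomputable def permCoeff (σ : Equiv.Perm (Fin n)) : K :=
  ∑ j, (n.factorial : K)⁻¹ • (Module.finBasis K (Q.obj (coordSpace K n))).coord j
    (θ _ (polar hQ _ _ (fun i => toCoord (σ i) (LinearMap.proj i : (Fin n → K) →ₗ[K] K))
      (Module.finBasis K (Q.obj (coordSpace K n)) j)))

include hθ in
-- Insert the decomposition of the identity of `Q(V)`, turn the trace around so that it is taken on
-- the tensor power, and move `f` through `fromTensor` by naturality.
theorem trace_comp_lmap [CharZero K] (V : FGModuleCat.{u} K) (f : V →ₗ[K] V) :
    LinearMap.trace K (Q.obj V) (θ V ∘ₗ lmap Q f) = ∑ σ : Equiv.Perm (Fin n),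
      permCoeff hQ θ σ * LinearMap.trace K _
        ((PiTensorProduct.reindex K (fun _ : Fin n => V) σ).toLinearMap ∘ₗ
          PiTensorProduct.map fun _ => f) := by
  let e := Module.finBasis K (Q.obj (coordSpace K n))
  have h1 : θ V ∘ₗ lmap Q f = ∑ j, (θ V ∘ₗ lmap Q f ∘ₗ fromTensor hQ (e j) V) ∘ₗ
      toTensor hQ (e.coord j) V := by
    have h := congrArg (fun z => (θ V ∘ₗ lmap Q f) ∘ₗ z) (sum_fromTensor_comp_toTensor hQ e V)
    simp only [LinearMap.comp_id] at h
    rw [← h, LinearMap.comp_finsetSum]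
    rfl
  have h2 : ∀ j, toTensor hQ (e.coord j) V ∘ₗ (θ V ∘ₗ lmap Q f ∘ₗ fromTensor hQ (e j) V) =
      (toTensor hQ (e.coord j) V ∘ₗ θ V ∘ₗ fromTensor hQ (e j) V) ∘ₗ
        PiTensorProduct.map fun _ => f := by
    intro j
    refine LinearMap.ext fun y => ?_
    simp only [LinearMap.comp_apply, fromTensor_map]
  rw [h1, map_sum]
  refine (Finset.sum_congr rfl fun j _ => LinearMap.trace_comp_comm' _ _).trans ?_
  simp only [h2, toTensor_comp_fromTensor hQ θ hθ,
    LinearMap.finsetSum_comp, map_sum, LinearMap.smul_comp, map_smul]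
  rw [Finset.sum_comm]
  refine Finset.sum_congr rfl fun σ _ => ?_
  rw [permCoeff, Finset.sum_mul]
  simp only [smul_eq_mul]
  rfl

include hθ in
-- Natural maps commute with every `ρ g`, so the whole decomposition restricts to invariants. The
-- coefficients are those of `trace_comp_lmap`; this coincidence links invariants to characters.
theorem trace_restrict_invariants [CharZero K] {G : Type w} [Group G] (V : FGModuleCat.{u} K)
    (ρ : Representation K G V)
    (h : ∀ x ∈ (mapRep Q ρ).invariants, θ V x ∈ (mapRep Q ρ).invariants) :
    LinearMap.trace K _ ((θ V).restrict h) = ∑ σ : Equiv.Perm (Fin n),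
      permCoeff hQ θ σ * LinearMap.trace K _ (permInvariants ρ n σ) := by
  let e := Module.finBasis K (Q.obj (coordSpace K n))
  have ht : ∀ j, ∀ x ∈ (mapRep Q ρ).invariants,
      toTensor hQ (e.coord j) V x ∈ (tensorPowerRep ρ n).invariants := fun j x hx g =>
    (toTensor_lmap hQ (e.coord j) (ρ g) x).symm.trans (congrArg _ (hx g))
  have hf : ∀ j, ∀ y ∈ (tensorPowerRep ρ n).invariants,
      fromTensor hQ (e j) V y ∈ (mapRep Q ρ).invariants := fun j y hy g =>
    (fromTensor_map hQ (e j) (ρ g) y).symm.trans (congrArg _ (hy g))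
  have h1 : (θ V).restrict h = ∑ j, ((θ V).restrict h ∘ₗ (fromTensor hQ (e j) V).restrict (hf j)) ∘ₗ
      (toTensor hQ (e.coord j) V).restrict (ht j) := by
    refine LinearMap.ext fun x => Subtype.ext ?_
    have h := LinearMap.congr_fun (sum_fromTensor_comp_toTensor hQ e V) (x : Q.obj V)
    rw [LinearMap.sum_apply, LinearMap.id_apply] at h
    rw [LinearMap.sum_apply, AddSubmonoidClass.coe_finsetSum]
    refine (congrArg (θ V) h.symm).trans ?_
    rw [map_sum]
    rfl
  have h2 : ∀ j, (toTensor hQ (e.coord j) V).restrict (ht j) ∘ₗ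
      ((θ V).restrict h ∘ₗ (fromTensor hQ (e j) V).restrict (hf j)) =
      ∑ σ : Equiv.Perm (Fin n), ((n.factorial : K)⁻¹ • e.coord j
        (θ _ (polar hQ _ _ (fun i => toCoord (σ i) (LinearMap.proj i : (Fin n → K) →ₗ[K] K))
          (e j)))) • permInvariants ρ n σ := by
    intro j
    refine LinearMap.ext fun y => Subtype.ext ?_
    refine (LinearMap.congr_fun (toTensor_comp_fromTensor hQ θ hθ (e.coord j) (e j) V)
      (y : ⨂[K] _ : Fin n, V)).trans ?_
    rw [LinearMap.sum_apply, LinearMap.sum_apply, AddSubmonoidClass.coe_finsetSum]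
    rfl
  rw [h1, map_sum]
  refine (Finset.sum_congr rfl fun j _ => LinearMap.trace_comp_comm' _ _).trans ?_
  simp only [h2, map_sum, map_smul]
  rw [Finset.sum_comm]
  refine Finset.sum_congr rfl fun σ _ => ?_
  rw [permCoeff, Finset.sum_mul]
  simp only [smul_eq_mul]
  rfl

end FGModuleCat

/-! ### The functor `P^{⊗r}` and the permutations of its factors. -/

namespace FGModuleCat

open scoped TensorProduct

variable {K : Type u} [Field K] (P : FGModuleCat.{u} K ⥤ FGModuleCat.{u} K)

/-- The functor `V ↦ P(V)^{⊗ r}`. -/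
noncomputable def tensorFunctor (r : ℕ) : FGModuleCat.{u} K ⥤ FGModuleCat.{u} K where
  obj V := FGModuleCat.of K (⨂[K] _ : Fin r, P.obj V)
  map f := FGModuleCat.ofHom (PiTensorProduct.map fun _ => (P.map f).hom.hom)
  map_id V := by
    rw [P.map_id]
    exact congrArg FGModuleCat.ofHom PiTensorProduct.map_id
  map_comp f g := by
    rw [P.map_comp]
    exact congrArg FGModuleCat.ofHom (PiTensorProduct.map_comp _ _)

variable {P}

theorem isHomogeneousPolynomialFunctor_tensorFunctor {k : ℕ}
    (hP : IsHomogeneousPolynomialFunctor P k) (r : ℕ) :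
    IsHomogeneousPolynomialFunctor (tensorFunctor P r) (r * k) := by
  classical
  intro U W m f
  obtain ⟨c, hc, h⟩ := hP U W m f
  let T : (Fin r → c.support) → ((tensorFunctor P r).obj U ⟶ (tensorFunctor P r).obj W) :=
    fun p => FGModuleCat.ofHom (PiTensorProduct.map fun l => (c (p l)).hom.hom)
  -- Expanding the tensor power of a sum gives one term for each choice `p` of a monomial in every
  -- factor. Different choices may have the same total exponent, and the sum of `Finsupp.single`
  -- collects them.
  refine ⟨∑ p : Fin r → c.support, Finsupp.single (∑ l, (p l : Fin m →₀ ℕ)) (T p),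
    fun α hα => ?_, fun t => ?_⟩
  · obtain ⟨p, _, hp⟩ := Finset.mem_biUnion.1 (Finsupp.support_finsetSum hα)
    rw [Finset.mem_singleton.1 (Finsupp.support_single_subset hp), map_sum,
      Finset.sum_congr rfl fun l _ => hc _ (p l).2]
    simp
  · rw [← Finsupp.sum_finsetSum_index (h := fun (α : Fin m →₀ ℕ)
      (x : (tensorFunctor P r).obj U ⟶ (tensorFunctor P r).obj W) => (∏ i, t i ^ α i) • x)
      (fun _ => smul_zero _) fun _ _ _ => smul_add _ _ _]
    have h1 : (P.map (∑ i, t i • f i)).hom.hom =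
        ∑ α : c.support, (∏ i, t i ^ (α : Fin m →₀ ℕ) i) • (c α).hom.hom := by
      rw [h t, Finsupp.sum]
      refine (map_sum (homLinear _ _) _ _).trans ?_
      rw [← Finset.sum_coe_sort]
      rfl
    have h2 : ((tensorFunctor P r).map (∑ i, t i • f i)).hom.hom =
        PiTensorProduct.map fun _ => (P.map (∑ i, t i • f i)).hom.hom := rfl
    have h3 : ∀ x y : (tensorFunctor P r).obj U ⟶ (tensorFunctor P r).obj W,
        x.hom.hom = y.hom.hom → x = y := fun x y hxy => congrArg FGModuleCat.ofHom hxy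
    refine h3 _ _ ?_
    refine Eq.trans ?_ (map_sum (homLinear _ _) _ _).symm
    rw [h2, h1, ← PiTensorProduct.mapMultilinear_apply, MultilinearMap.map_sum]
    refine Finset.sum_congr rfl fun p _ => ?_
    have h5 := Finsupp.sum_single_index (a := ∑ l, (p l : Fin m →₀ ℕ)) (b := T p)
      (h := fun (α : Fin m →₀ ℕ)
        (x : (tensorFunctor P r).obj U ⟶ (tensorFunctor P r).obj W) => (∏ i, t i ^ α i) • x)
      (smul_zero _)
    rw [MultilinearMap.map_smul_univ]
    refine Eq.trans ?_ (congrArg (homLinear _ _) h5).symm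
    refine Eq.trans ?_ (map_smul (homLinear _ _) _ _).symm
    have h4 : ∏ i, t i ^ (∑ l, (p l : Fin m →₀ ℕ)) i = ∏ l, ∏ i, t i ^ (p l : Fin m →₀ ℕ) i := by
      rw [Finset.prod_comm]
      refine Finset.prod_congr rfl fun i _ => ?_
      rw [Finsupp.finsetSum_apply, Finset.prod_pow_eq_pow_sum]
    simp only [h4]
    rfl

variable (P) in
/-- The permutation of the tensor factors of `P(V)^{⊗ r}`. -/
noncomputable def permTensor (r : ℕ) (π : Equiv.Perm (Fin r)) (V : FGModuleCat.{u} K) :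
    (tensorFunctor P r).obj V →ₗ[K] (tensorFunctor P r).obj V :=
  (PiTensorProduct.reindex K (fun _ : Fin r => P.obj V) π).toLinearMap

variable (P) in
theorem permTensor_comp_lmap (r : ℕ) (π : Equiv.Perm (Fin r)) (U W : FGModuleCat.{u} K)
    (f : U →ₗ[K] W) : permTensor P r π W ∘ₗ lmap (tensorFunctor P r) f =
      lmap (tensorFunctor P r) f ∘ₗ permTensor P r π U :=
  (PiTensorProduct.map_comp_reindex_eq (fun _ : Fin r => lmap P f) π).symm

/-- The functor `P^{⊗r}` applied to `ρ` is by definition the `r`-th tensor power of `P` applied to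
`ρ`, so the trace formula on invariants applies with `θ = π`. -/
theorem trace_permInvariants_mapRep [CharZero K] {k : ℕ}
    (hP : IsHomogeneousPolynomialFunctor P k) (r : ℕ) (π : Equiv.Perm (Fin r))
    {G : Type w} [Group G] (V : FGModuleCat.{u} K) (ρ : Representation K G V) :
    LinearMap.trace K _ (permInvariants (mapRep P ρ) r π) = ∑ σ : Equiv.Perm (Fin (r * k)),
      permCoeff (isHomogeneousPolynomialFunctor_tensorFunctor hP r) (permTensor P r π) σ *
        LinearMap.trace K _ (permInvariants ρ (r * k) σ) :=
  trace_restrict_invariants (isHomogeneousPolynomialFunctor_tensorFunctor hP r)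
    (permTensor P r π) (permTensor_comp_lmap P r π) V ρ fun x hx g =>
      (PiTensorProduct.map_reindex (fun _ : Fin r => lmap P (ρ g)) π x).trans
        (congrArg _ (hx g))

/-- Both sides compute the trace of `π ∘ P(f)^{⊗r}`, on the left by cycles of `π`, on the right by
the natural decomposition. -/
theorem prod_trace_lmap_pow [CharZero K] {k : ℕ}
    (hP : IsHomogeneousPolynomialFunctor P k) (r : ℕ) (π : Equiv.Perm (Fin r))
    (V : FGModuleCat.{u} K) (f : V →ₗ[K] V) :
    (π.partition.parts.map fun l => LinearMap.trace K _ (lmap P (f ^ l))).prod =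
      ∑ σ : Equiv.Perm (Fin (r * k)),
      permCoeff (isHomogeneousPolynomialFunctor_tensorFunctor hP r) (permTensor P r π) σ *
        (σ.partition.parts.map fun l => LinearMap.trace K _ (f ^ l)).prod := by
  have h1 : ∀ l, lmap P (f ^ l) = lmap P f ^ l := fun l => by
    induction l with
    | zero => exact lmap_id P V
    | succ l ih => rw [pow_succ, pow_succ, ← ih]; exact lmap_comp P _ _
  simp only [h1]
  rw [← trace_reindex_comp_map]
  simp only [← trace_reindex_comp_map]
  exact trace_comp_lmap (isHomogeneousPolynomialFunctor_tensorFunctor hP r)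
    (permTensor P r π) (permTensor_comp_lmap P r π) V f

theorem trace_lmap [CharZero K] {k : ℕ} (hP : IsHomogeneousPolynomialFunctor P k)
    (V : FGModuleCat.{u} K) (f : V →ₗ[K] V) :
    LinearMap.trace K _ (lmap P f) = ∑ σ : Equiv.Perm (Fin k),
      permCoeff hP (fun _ => LinearMap.id) σ *
        (σ.partition.parts.map fun l => LinearMap.trace K _ (f ^ l)).prod := by
  simp only [← trace_reindex_comp_map]
  exact trace_comp_lmap hP (fun _ => LinearMap.id) (fun _ _ _ => rfl) V f

end FGModuleCat

/-! ### Evaluation of symmetric functions. -/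

namespace SymFun

variable {K : Type*} [Field K]

theorem exists_coe_eq_restrict (n : ℕ) (F : SymFun K) :
    ∃ q : MvPolynomial (Fin n) K, (q : MvPowerSeries (Fin n) K) = restrict K n F := by
  obtain ⟨d, hd⟩ := F.2.1
  refine ⟨MvPowerSeries.truncTotal (d + 1) (restrict K n F), ?_⟩
  ext β
  rw [MvPolynomial.coeff_coe, MvPowerSeries.coeff_truncTotal_eq_ite]
  split_ifs with hβ
  · rfl
  · by_contra hne
    rw [coeff_restrict] at hne
    have := hd _ (Ne.symm hne)
    rw [Finsupp.degree_apply, Finsupp.support_embDomain, Finset.sum_map] at this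
    simp only [Finsupp.embDomain_apply_self] at this
    rw [Finsupp.degree_apply] at hβ
    omega

theorem evalAt_eq_eval {n : ℕ} (a : Fin n → K) (F : SymFun K) (q : MvPolynomial (Fin n) K)
    (hq : (q : MvPowerSeries (Fin n) K) = restrict K n F) :
    evalAt a F = MvPolynomial.eval a q := by
  unfold evalAt
  simp only [← coeff_restrict, ← hq, MvPolynomial.coeff_coe]
  rw [MvPolynomial.eval_eq', finsum_eq_sum_of_support_subset]
  intro β hβ
  rw [Finset.mem_coe, MvPolynomial.mem_support_iff]
  exact left_ne_zero_of_mul hβ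

/-- Evaluation of symmetric functions, as an algebra homomorphism. -/
noncomputable def evalHom {n : ℕ} (a : Fin n → K) : SymFun K →ₐ[K] K where
  toFun := evalAt a
  map_one' := by
    rw [evalAt_eq_eval a 1 1 (by rw [map_one, MvPolynomial.coe_one]), map_one]
  map_mul' F F' := by
    obtain ⟨q, hq⟩ := exists_coe_eq_restrict n F
    obtain ⟨q', hq'⟩ := exists_coe_eq_restrict n F'
    rw [evalAt_eq_eval a _ _ hq, evalAt_eq_eval a _ _ hq', ← map_mul]
    exact evalAt_eq_eval a _ _ (by rw [MvPolynomial.coe_mul, hq, hq', map_mul])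
  map_zero' := by
    rw [evalAt_eq_eval a 0 0 (by rw [map_zero, MvPolynomial.coe_zero]), map_zero]
  map_add' F F' := by
    obtain ⟨q, hq⟩ := exists_coe_eq_restrict n F
    obtain ⟨q', hq'⟩ := exists_coe_eq_restrict n F'
    rw [evalAt_eq_eval a _ _ hq, evalAt_eq_eval a _ _ hq', ← map_add]
    exact evalAt_eq_eval a _ _ (by rw [MvPolynomial.coe_add, hq, hq', map_add])
  commutes' c := by
    rw [evalAt_eq_eval a _ (MvPolynomial.C c) (by
      rw [AlgHom.commutes, MvPolynomial.coe_C]; rfl), MvPolynomial.eval_C]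
    rfl

theorem evalHom_apply {n : ℕ} (a : Fin n → K) (F : SymFun K) : evalHom a F = evalAt a F := rfl

theorem evalHom_p {n : ℕ} (a : Fin n → K) (l : ℕ) (hl : 0 < l) :
    evalHom a (p K l) = ∑ i, a i ^ l := by
  rw [evalHom_apply, evalAt_eq_eval a _ _ (restrict_p K n l hl).symm, MvPolynomial.psum, map_sum]
  simp

theorem evalHom_h {n : ℕ} (a : Fin n → K) (r : ℕ) :
    evalHom a (h K r) = ∑ β ∈ Finset.finsuppAntidiag (Finset.univ : Finset (Fin n)) r,
      ∏ i, a i ^ β i := by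
  classical
  have hdeg : ∀ β : Fin n →₀ ℕ, (β.embDomain Fin.valEmbedding).degree = β.degree := by
    intro β
    rw [Finsupp.degree_apply, Finsupp.degree_apply, Finsupp.support_embDomain, Finset.sum_map]
    exact Finset.sum_congr rfl fun i _ => Finsupp.embDomain_apply_self _ _ _
  have hc : ∀ β : Fin n →₀ ℕ, MvPowerSeries.coeff (β.embDomain Fin.valEmbedding)
      (h K r : MvPowerSeries ℕ K) = if β.degree = r then 1 else 0 := fun β => by
    rw [← hdeg β]
    exact if_congr Iff.rfl rfl rfl
  rw [evalHom_apply]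
  unfold evalAt
  simp only [hc, ite_mul, one_mul, zero_mul]
  have hs : ∀ β : Fin n →₀ ℕ, β ∈ Finset.finsuppAntidiag (Finset.univ : Finset (Fin n)) r ↔
      β.degree = r := fun β => by
    rw [Finset.mem_finsuppAntidiag, Finsupp.degree_eq_sum]
    simp
  rw [finsum_eq_sum_of_support_subset _ (s := Finset.finsuppAntidiag Finset.univ r)]
  · exact Finset.sum_congr rfl fun β hβ => if_pos ((hs β).1 hβ)
  · intro β hβ
    rw [Finset.mem_coe, hs]
    by_contra hne
    exact hβ (if_neg hne)

/-- As many variables as the degree bound suffice. Multiplying by the product of the variables makes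
the polynomial vanish also where some coordinate is zero, so it is zero over an infinite field. -/
theorem ext_of_evalAt [Infinite K] (F F' : SymFun K)
    (hF : ∀ (n : ℕ) (a : Fin n → K), (∀ i, a i ≠ 0) → evalAt a F = evalAt a F') : F = F' := by
  obtain ⟨N, hN⟩ := (F - F').2.1
  rw [← sub_eq_zero]
  refine eq_zero_of_restrict K N _ hN ?_
  obtain ⟨q, hq⟩ := exists_coe_eq_restrict N (F - F')
  rw [← hq]
  suffices h : q * ∏ i, MvPolynomial.X i = 0 by
    rcases mul_eq_zero.1 h with h | h
    · rw [h, MvPolynomial.coe_zero]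
    · obtain ⟨i, _, hi⟩ := Finset.prod_eq_zero_iff.1 h
      exact absurd hi (MvPolynomial.X_ne_zero i)
  refine MvPolynomial.funext fun a => ?_
  rw [map_mul, map_prod, map_zero]
  by_cases ha : ∀ i, a i ≠ 0
  · rw [← evalAt_eq_eval a _ q hq, ← evalHom_apply, map_sub, evalHom_apply, evalHom_apply,
      hF N a ha, sub_self, zero_mul]
  · push Not at ha
    obtain ⟨i, hi⟩ := ha
    rw [Finset.prod_eq_zero (Finset.mem_univ i) (by rw [MvPolynomial.eval_X, hi]), mul_zero]

variable [CharZero K]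

theorem powerSumEquiv_symm_p (n : ℕ+) : (powerSumEquiv K).symm (p K n) = MvPolynomial.X n := by
  rw [AlgEquiv.symm_apply_eq]
  exact (MvPolynomial.aeval_X (fun n : ℕ+ => p K n) n).symm

theorem algHom_ext {A : Type*} [CommSemiring A] [Algebra K A] (f g : SymFun K →ₐ[K] A)
    (hfg : ∀ n : ℕ+, f (p K n) = g (p K n)) : f = g := by
  have h : f.comp (powerSumEquiv K : MvPolynomial ℕ+ K →ₐ[K] SymFun K) =
      g.comp (powerSumEquiv K : MvPolynomial ℕ+ K →ₐ[K] SymFun K) := by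
    refine MvPolynomial.algHom_ext fun n => ?_
    have h1 : powerSumEquiv K (MvPolynomial.X n) = p K n :=
      MvPolynomial.aeval_X (fun n : ℕ+ => p K n) n
    simp only [AlgHom.comp_apply, AlgEquiv.coe_toAlgHom, h1, hfg]
  refine AlgHom.ext fun F => ?_
  obtain ⟨q, rfl⟩ := (powerSumEquiv K).surjective F
  exact DFunLike.congr_fun h q

theorem adams_p (n m : ℕ+) : adams K n (p K m) = p K (m * n) := by
  rw [adams, AlgHom.comp_apply, AlgEquiv.coe_toAlgHom, powerSumEquiv_symm_p, MvPolynomial.aeval_X]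

theorem evalHom_adams {n : ℕ} (a : Fin n → K) (l : ℕ+) (F : SymFun K) :
    evalHom a (adams K l F) = evalHom (fun i => a i ^ (l : ℕ)) F := by
  rw [← AlgHom.comp_apply]
  refine DFunLike.congr_fun (algHom_ext _ _ fun m => ?_) F
  rw [AlgHom.comp_apply, adams_p, evalHom_p _ _ m.pos, ← PNat.mul_coe, evalHom_p _ _ (m * l).pos]
  simp only [PNat.mul_coe, ← pow_mul, mul_comm]

end SymFun

/-! ### The scalar product on power sums and conjugacy classes. -/

namespace SymFun

variable {K : Type*} [Field K] [CharZero K]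

/-- The exponents of the monomial `p_λ` in the power sums, for a multiset `λ` of positive
integers. -/
noncomputable def exponents (s : Multiset ℕ) : ℕ+ →₀ ℕ :=
  Multiset.toFinsupp (s.map Nat.toPNat')

/-- Positivity is needed because `Nat.toPNat'` sends `0` to `1`. -/
theorem prod_p_eq (s : Multiset ℕ) (hs : ∀ i ∈ s, 0 < i) :
    (s.map fun i => p K i).prod = powerSumEquiv K (MvPolynomial.monomial (exponents s) 1) := by
  induction s using Multiset.induction_on with
  | empty =>
    rw [Multiset.map_zero, Multiset.prod_zero]
    exact (map_one (powerSumEquiv K)).symm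
  | cons i s ih =>
    have h1 : exponents (i ::ₘ s) = Finsupp.single i.toPNat' 1 + exponents s := by
      rw [exponents, Multiset.map_cons, ← Multiset.singleton_add, map_add,
        Multiset.toFinsupp_singleton]
      rfl
    have h2 : (MvPolynomial.monomial (exponents (i ::ₘ s)) (1 : K)) =
        MvPolynomial.X i.toPNat' * MvPolynomial.monomial (exponents s) 1 := by
      rw [h1, MvPolynomial.X, MvPolynomial.monomial_mul, one_mul]
    have h3 : powerSumEquiv K (MvPolynomial.X i.toPNat') = p K i := by
      rw [← AlgEquiv.eq_symm_apply]
      have := powerSumEquiv_symm_p (K := K) i.toPNat'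
      rw [Nat.toPNat'_coe, if_pos (hs i (Multiset.mem_cons_self i s))] at this
      exact this.symm
    rw [Multiset.map_cons, Multiset.prod_cons, h2, map_mul, h3,
      ih fun j hj => hs j (Multiset.mem_cons_of_mem hj)]

theorem scalar_monomial (m m' : ℕ+ →₀ ℕ) :
    scalar K (powerSumEquiv K (MvPolynomial.monomial m 1))
      (powerSumEquiv K (MvPolynomial.monomial m' 1)) = if m' = m then (zee m : K) else 0 := by
  classical
  rw [scalar, LinearMap.compl₁₂_apply]
  simp only [AlgEquiv.toLinearMap_apply, AlgEquiv.symm_apply_apply]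
  have h := (MvPolynomial.basisMonomials ℕ+ K).constr_basis K
    (fun m => (zee m : K) • MvPolynomial.lcoeff K m) m
  rw [MvPolynomial.coe_basisMonomials] at h
  rw [h, LinearMap.smul_apply, MvPolynomial.lcoeff_apply, MvPolynomial.coeff_monomial]
  split_ifs <;> simp

theorem exponents_injOn {s t : Multiset ℕ} (hs : ∀ i ∈ s, 0 < i) (ht : ∀ i ∈ t, 0 < i)
    (h : exponents s = exponents t) : s = t := by
  have h1 := Multiset.toFinsupp.injective h
  have h2 : ∀ u : Multiset ℕ, (∀ i ∈ u, 0 < i) →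
      (u.map Nat.toPNat').map (fun n : ℕ+ => (n : ℕ)) = u := by
    intro u hu
    rw [Multiset.map_map]
    conv_rhs => rw [← Multiset.map_id u]
    refine Multiset.map_congr rfl fun i hi => ?_
    simp [hu i hi]
  rw [← h2 s hs, ← h2 t ht, h1]

/-- The shape matches the class size formula `Equiv.Perm.card_isConj_mul_eq`, in which `c` lists the
nontrivial cycles and the `f` fixed points contribute `1 ^ f * f!`. -/
theorem zee_exponents_add_replicate (c : Multiset ℕ) (hc : ∀ i ∈ c, 2 ≤ i) (f : ℕ) :
    zee (exponents (c + Multiset.replicate f 1)) =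
      f.factorial * c.prod * ∏ i ∈ c.toFinset, (c.count i).factorial := by
  have hpos : ∀ i ∈ c, i.toPNat' = (i : ℕ) := fun i hi => by
    have := hc i hi
    rw [Nat.toPNat'_coe, if_pos (by omega)]
  have h1 : exponents (c + Multiset.replicate f 1) = exponents c + Finsupp.single 1 f := by
    rw [exponents, exponents, Multiset.map_add, map_add, Multiset.map_replicate]
    congr 1
    ext n
    rw [Multiset.toFinsupp_apply, Multiset.count_replicate, Finsupp.single_apply]
    rfl
  have hinj : Set.InjOn Nat.toPNat' {i | i ∈ c} := fun i hi j hj hij => by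
    rw [← hpos i hi, ← hpos j hj, hij]
  have hcount : ∀ i ∈ c, exponents c i.toPNat' = c.count i := fun i hi => by
    rw [exponents, Multiset.toFinsupp_apply, Multiset.count_map_eq_count _ _ hinj _ hi]
  have h2 : (exponents c).support = c.toFinset.image Nat.toPNat' := by
    rw [exponents, Multiset.toFinsupp_support]
    ext n
    simp
  have hd : Disjoint (exponents c).support (Finsupp.single (1 : ℕ+) f).support := by
    rw [h2]
    refine Finset.disjoint_of_subset_right Finsupp.support_single_subset ?_
    rw [Finset.disjoint_singleton_right, Finset.mem_image]
    rintro ⟨i, hi, h⟩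
    have h3 := hpos i (Multiset.mem_toFinset.1 hi)
    have h4 := hc i (Multiset.mem_toFinset.1 hi)
    rw [h, PNat.one_coe] at h3
    omega
  rw [zee, h1, Finsupp.prod_add_index_of_disjoint hd, Finsupp.prod_single_index (by simp),
    PNat.one_coe, one_pow, one_mul, Finsupp.prod, h2, Finset.prod_image fun i hi j hj =>
      hinj (Multiset.mem_toFinset.1 hi) (Multiset.mem_toFinset.1 hj),
    Finset.prod_congr rfl fun i hi => by
      rw [hpos i (Multiset.mem_toFinset.1 hi), hcount i (Multiset.mem_toFinset.1 hi)],
    Finset.prod_mul_distrib, ← Finset.prod_multiset_count]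
  ring

open Classical in
theorem card_isConj_mul_zee {n : ℕ} (σ : Equiv.Perm (Fin n)) :
    (Finset.univ.filter fun τ => IsConj σ τ).card * zee (exponents σ.partition.parts) =
      n.factorial := by
  have h := Equiv.Perm.card_isConj_mul_eq σ
  rw [Fintype.card_fin] at h
  rw [Equiv.Perm.parts_partition, zee_exponents_add_replicate _
    fun i hi => Equiv.Perm.two_le_of_mem_cycleType hi, Fintype.card_fin, ← Equiv.Perm.sum_cycleType,
    ← h]
  congr 1
  rw [Nat.card_eq_fintype_card, Fintype.card_subtype]
  rfl

/-- The scalar product of a power sum with the Frobenius characteristic of a class function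
recovers the value of the class function. -/
theorem scalar_prod_p_sum {n : ℕ} (χ : Equiv.Perm (Fin n) → K)
    (hχ : ∀ σ τ, IsConj σ τ → χ σ = χ τ) (σ : Equiv.Perm (Fin n)) :
    scalar K (σ.partition.parts.map fun i => p K i).prod
      ((n.factorial : K)⁻¹ • ∑ τ : Equiv.Perm (Fin n),
        χ τ • (τ.partition.parts.map fun i => p K i).prod) = χ σ := by
  classical
  have hpos : ∀ τ : Equiv.Perm (Fin n), ∀ i ∈ τ.partition.parts, 0 < i := fun τ i hi =>
    τ.partition.parts_pos hi
  have h1 : ∀ τ : Equiv.Perm (Fin n),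
      exponents τ.partition.parts = exponents σ.partition.parts ↔ IsConj σ τ := fun τ => by
    rw [Equiv.Perm.partition_eq_of_isConj, Nat.Partition.ext_iff]
    exact ⟨fun h => (exponents_injOn (hpos τ) (hpos σ) h).symm, fun h => by rw [h]⟩
  rw [map_smul, map_sum]
  have h2 : ∀ τ : Equiv.Perm (Fin n), scalar K (σ.partition.parts.map fun i => p K i).prod
      (χ τ • (τ.partition.parts.map fun i => p K i).prod) =
      if IsConj σ τ then χ σ * (zee (exponents σ.partition.parts) : K) else 0 := fun τ => by
    rw [map_smul, prod_p_eq _ (hpos σ), prod_p_eq _ (hpos τ), scalar_monomial]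
    simp only [h1]
    split_ifs with h
    · rw [hχ σ τ h, smul_eq_mul]
    · rw [smul_zero]
  simp only [h2]
  rw [← Finset.sum_filter, Finset.sum_const, nsmul_eq_mul, smul_eq_mul]
  have h3 := congrArg (Nat.cast : ℕ → K) (card_isConj_mul_zee σ)
  rw [Nat.cast_mul] at h3
  have hn : (n.factorial : K) ≠ 0 := Nat.cast_ne_zero.2 n.factorial_ne_zero
  rw [inv_mul_eq_iff_eq_mul₀ hn, ← h3]
  ring

end SymFun

/-! ### Counting words, and the power sum expansion of `h_r`. -/

section WordCount

variable {κ K : Type*} [DecidableEq κ] [Field K]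

/-- Words with the same content differ by a permutation of the letters. -/
theorem exists_perm_of_map_univ_eq {r : ℕ} (w w' : Fin r → κ)
    (h : Finset.univ.val.map w = Finset.univ.val.map w') : ∃ τ : Equiv.Perm (Fin r), w' ∘ τ = w := by
  have hc : ∀ c, Nonempty ({i // w i = c} ≃ {i // w' i = c}) := fun c => by
    refine Fintype.card_eq.1 ?_
    have := congrArg (Multiset.count c) h
    rw [Multiset.count_map, Multiset.count_map] at this
    rw [Fintype.card_subtype, Fintype.card_subtype, Finset.card_def, Finset.card_def,
      Finset.filter_val, Finset.filter_val]
    simpa only [eq_comm] using this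
  exact ⟨Equiv.ofFiberEquiv fun c => (hc c).some, funext fun i => Equiv.ofFiberEquiv_map _ i⟩

variable [Fintype κ]

/-- Words of given content form one orbit of the symmetric group, so their stabilizer orders add up
to `r!`. -/
theorem sum_card_stabilizer_eq {r : ℕ} (g : Multiset κ → K) :
    ∑ w : Fin r → κ, ((Finset.univ.filter fun π : Equiv.Perm (Fin r) => w ∘ π = w).card : K) *
      g (Finset.univ.val.map w) = (r.factorial : K) *
        ∑ s ∈ Finset.univ.image fun w : Fin r → κ => Finset.univ.val.map w, g s := by
  rw [Finset.mul_sum, ← Finset.sum_fiberwise_of_maps_to (t := Finset.univ.image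
    fun w : Fin r → κ => Finset.univ.val.map w) fun w _ => Finset.mem_image_of_mem _ (Finset.mem_univ w)]
  refine Finset.sum_congr rfl fun s hs => ?_
  obtain ⟨w₀, _, rfl⟩ := Finset.mem_image.1 hs
  -- If `w = w₀ ∘ τ`, then `π ↦ τ * π` maps the stabilizer of `w` onto the permutations carrying
  -- `w₀` to `w`. Summed over `w`, these exhaust all permutations.
  have h1 : ∀ w ∈ Finset.univ.filter fun w : Fin r → κ =>
      Finset.univ.val.map w = Finset.univ.val.map w₀,
      ((Finset.univ.filter fun π : Equiv.Perm (Fin r) => w ∘ π = w).card : K) *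
        g (Finset.univ.val.map w) =
      ((Finset.univ.filter fun π : Equiv.Perm (Fin r) => w₀ ∘ π = w).card : K) *
        g (Finset.univ.val.map w₀) := by
    intro w hw
    obtain ⟨τ, rfl⟩ := exists_perm_of_map_univ_eq w w₀ (Finset.mem_filter.1 hw).2
    rw [(Finset.mem_filter.1 hw).2]
    congr 2
    refine Finset.card_equiv (Equiv.mulLeft τ) fun π => ?_
    simp only [Finset.mem_filter, Finset.mem_univ, true_and, Equiv.coe_mulLeft,
      Equiv.Perm.coe_mul, Function.comp_assoc]
  rw [Finset.sum_congr rfl h1, ← Finset.sum_mul, ← Nat.cast_sum]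
  congr 2
  rw [← Finset.card_eq_sum_card_fiberwise, Finset.card_univ, Fintype.card_perm, Fintype.card_fin]
  intro π _
  rw [Finset.mem_coe, Finset.mem_filter]
  refine ⟨Finset.mem_univ _, ?_⟩
  rw [← Multiset.map_map]
  congr 1
  exact congrArg Finset.val (Finset.map_univ_equiv π)

end WordCount

namespace SymFun

variable {K : Type*} [Field K]

/-- For a diagonal matrix the cycle sum of `π` only sees the words fixed by `π`. Exchanging the sums
weights each word by its stabilizer, and `r!` times a sum over multisets of indices, that is over
monomials, remains. -/
theorem sum_cycleSum_diagonal {n r : ℕ} (a : Fin n → K) :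
    ∑ π : Equiv.Perm (Fin r), (π.partition.parts.map fun l => ∑ i, a i ^ l).prod =
      (r.factorial : K) * ∑ β ∈ Finset.finsuppAntidiag (Finset.univ : Finset (Fin n)) r,
        ∏ i, a i ^ β i := by
  have h1 : ∀ π : Equiv.Perm (Fin r), (π.partition.parts.map fun l => ∑ i, a i ^ l).prod =
      ∑ w : Fin r → Fin n, if w ∘ π = w then ∏ i, a (w i) else 0 := by
    intro π
    have h2 : ∀ l, ∑ i, a i ^ l = ((Matrix.diagonal a) ^ l).trace := fun l => by
      rw [Matrix.diagonal_pow, Matrix.trace_diagonal]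
      rfl
    simp only [h2]
    rw [← Equiv.Perm.cycleSum_eq_prod]
    refine Finset.sum_congr rfl fun w _ => ?_
    split_ifs with h
    · refine Finset.prod_congr rfl fun i _ => ?_
      have := congrFun h i
      rw [Function.comp_apply] at this
      rw [this, Matrix.diagonal_apply_eq]
    · obtain ⟨i, hi⟩ := Function.ne_iff.1 h
      exact Finset.prod_eq_zero (Finset.mem_univ i) (Matrix.diagonal_apply_ne' _ hi)
  simp only [h1]
  rw [Finset.sum_comm]
  have h3 := sum_card_stabilizer_eq (r := r) fun s : Multiset (Fin n) => (s.map a).prod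
  have h4 : ∀ w : Fin r → Fin n, ((Finset.univ.val.map w).map a).prod = ∏ i, a (w i) := fun w => by
    rw [Multiset.map_map]
    rfl
  simp only [h4] at h3
  simp only [← Finset.sum_filter, Finset.sum_const, nsmul_eq_mul]
  rw [h3]
  congr 1
  refine Finset.sum_bij (fun s _ => Multiset.toFinsupp s) (fun s hs => ?_)
    (fun s _ t _ h => Multiset.toFinsupp.injective h) (fun β hβ => ?_) fun s _ => ?_
  · obtain ⟨w, _, rfl⟩ := Finset.mem_image.1 hs
    rw [Finset.mem_finsuppAntidiag]
    refine ⟨?_, Finset.subset_univ _⟩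
    refine (Finset.sum_congr rfl fun i _ => Multiset.toFinsupp_apply _ i).trans ?_
    rw [Multiset.sum_count_eq_card fun i _ => Finset.mem_univ i, Multiset.card_map]
    exact Finset.card_fin r
  · rw [Finset.mem_finsuppAntidiag] at hβ
    have hl : (Finsupp.toMultiset β).toList.length = r := by
      rw [Multiset.length_toList, Finsupp.card_toMultiset, ← hβ.1, Finsupp.sum_fintype _ _ fun _ => rfl]
      rfl
    subst hl
    refine ⟨Finsupp.toMultiset β, Finset.mem_image.2
      ⟨(Finsupp.toMultiset β).toList.get, Finset.mem_univ _, ?_⟩, by simp⟩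
    rw [Fin.univ_val_map, List.ofFn_get, Multiset.coe_toList]
  · rw [Finset.prod_multiset_map_count]
    refine Finset.prod_subset (Finset.subset_univ _) fun i _ hi => ?_
    rw [Multiset.count_eq_zero_of_notMem (mt Multiset.mem_toFinset.2 hi), pow_zero]

theorem evalHom_prod_p {n r : ℕ} (a : Fin n → K) (π : Equiv.Perm (Fin r)) :
    evalHom a (π.partition.parts.map fun l => p K l).prod =
      (π.partition.parts.map fun l => ∑ i, a i ^ l).prod := by
  rw [map_multiset_prod, Multiset.map_map]
  exact congrArg Multiset.prod (Multiset.map_congr rfl fun l hl =>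
    evalHom_p a l (π.partition.parts_pos hl))

open scoped TensorProduct

theorem prod_map_tmul {ι : Type*} (s : Multiset ι) (f g : ι → SymFun K) :
    (s.map fun i => f i ⊗ₜ[K] g i).prod = (s.map f).prod ⊗ₜ[K] (s.map g).prod := by
  induction s using Multiset.induction_on with
  | empty => rfl
  | cons i s ih =>
    simp only [Multiset.map_cons, Multiset.prod_cons]
    rw [ih, Algebra.TensorProduct.tmul_mul_tmul]

variable [CharZero K]

/-- The expansion of the complete symmetric function in power sums. -/
theorem h_eq_sum (r : ℕ) : h K r = (r.factorial : K)⁻¹ • ∑ π : Equiv.Perm (Fin r),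
    (π.partition.parts.map fun l => p K l).prod := by
  have hn : (r.factorial : K) ≠ 0 := Nat.cast_ne_zero.2 r.factorial_ne_zero
  refine ext_of_evalAt _ _ fun n a _ => ?_
  rw [← evalHom_apply, ← evalHom_apply, evalHom_h, map_smul, map_sum]
  simp only [evalHom_prod_p]
  rw [sum_cycleSum_diagonal, smul_eq_mul, inv_mul_cancel_left₀ hn]

/-- The plethysm `f ↦ f[a]`, as an algebra homomorphism. -/
noncomputable def plethysmHom {A : Type*} [CommRing A] [Algebra K A] (ψ : ℕ+ → A →ₐ[K] A)
    (a : A) : SymFun K →ₐ[K] A :=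
  (MvPolynomial.aeval fun n => ψ n a).comp
    ((powerSumEquiv K).symm : SymFun K →ₐ[K] MvPolynomial ℕ+ K)

theorem plethysmHom_apply {A : Type*} [CommRing A] [Algebra K A] (ψ : ℕ+ → A →ₐ[K] A)
    (a : A) (f : SymFun K) : plethysmHom ψ a f = plethysm ψ f a := rfl

theorem plethysmHom_p {A : Type*} [CommRing A] [Algebra K A] (ψ : ℕ+ → A →ₐ[K] A) (l : ℕ+)
    (a : A) : plethysmHom ψ a (p K l) = ψ l a := by
  rw [plethysmHom_apply, plethysm, powerSumEquiv_symm_p, MvPolynomial.aeval_X]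

theorem adamsXY_inX_mul_inY (l : ℕ+) (F : SymFun K) :
    adamsXY K l (inX (p K 1) * inY F) = p K l ⊗ₜ[K] adams K l F := by
  have h := adams_p (K := K) l 1
  rw [PNat.one_coe, one_mul] at h
  rw [inX, inY, Algebra.TensorProduct.tmul_mul_tmul, mul_one, one_mul, ← h]
  exact Algebra.TensorProduct.map_tmul _ _ _ _

/-- The expansion of `h_r[X · F[Y]]` in power sums. -/
theorem plethysm_h (r : ℕ) (F : SymFun K) :
    plethysm (adamsXY K) (h K r) (inX (p K 1) * inY F) =
      (r.factorial : K)⁻¹ • ∑ π : Equiv.Perm (Fin r),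
        (π.partition.parts.map fun l => p K l).prod ⊗ₜ[K]
          (π.partition.parts.map fun l => adams K l.toPNat' F).prod := by
  rw [← plethysmHom_apply, h_eq_sum, map_smul, map_sum]
  congr 1
  refine Finset.sum_congr rfl fun π _ => ?_
  rw [map_multiset_prod, Multiset.map_map, ← prod_map_tmul]
  refine congrArg Multiset.prod (Multiset.map_congr rfl fun l hl => ?_)
  have hl' : ((l.toPNat' : ℕ+) : ℕ) = l := by
    rw [Nat.toPNat'_coe, if_pos (π.partition.parts_pos hl)]
  have h1 := plethysmHom_p (adamsXY K) l.toPNat' (inX (p K 1) * inY F)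
  rw [adamsXY_inX_mul_inY, hl'] at h1
  exact h1

theorem scalarY_tmul (f f' g : SymFun K) : scalarY (f ⊗ₜ[K] f') g = scalar K f' g • f := by
  rw [scalarY, LinearMap.lTensor_tmul, TensorProduct.rid_tmul]
  rfl

theorem scalarY_smul_sum {ι : Type*} (s : Finset ι) (c : K) (Φ : ι → TwoAlphabets K)
    (g : SymFun K) : scalarY (c • ∑ i ∈ s, Φ i) g = c • ∑ i ∈ s, scalarY (Φ i) g := by
  simp only [scalarY, map_smul, map_sum]

end SymFun

/-! ### Class functions on invariants, the character, and the theorem. -/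

section PermInvariants

open scoped TensorProduct

variable {K : Type*} [Field K] {G : Type*} [Group G] {V : Type*} [AddCommGroup V] [Module K V]

theorem permInvariants_mul (ρ : Representation K G V) (r : ℕ) (π τ : Equiv.Perm (Fin r)) :
    permInvariants ρ r (π * τ) = permInvariants ρ r π ∘ₗ permInvariants ρ r τ :=
  LinearMap.ext fun x => Subtype.ext
    (PiTensorProduct.reindex_reindex (R := K) (s := fun _ : Fin r => V) τ π x).symm

theorem trace_permInvariants_of_isConj [Module.Finite K V] (ρ : Representation K G V) (r : ℕ)
    {π τ : Equiv.Perm (Fin r)} (h : IsConj π τ) :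
    LinearMap.trace K _ (permInvariants ρ r π) = LinearMap.trace K _ (permInvariants ρ r τ) := by
  obtain ⟨c, rfl⟩ := isConj_iff.1 h
  rw [permInvariants_mul, LinearMap.trace_comp_comm', ← permInvariants_mul, ← mul_assoc,
    inv_mul_cancel, one_mul]

end PermInvariants

theorem trace_toLin_diagonal_pow {K : Type*} [Field K] {n : ℕ} (a : Fin n → K) (l : ℕ) :
    LinearMap.trace K _ (Matrix.toLin' (Matrix.diagonal a) ^ l) = ∑ i, a i ^ l := by
  rw [← Matrix.toLin'_pow, Matrix.diagonal_pow, Matrix.trace_toLin'_eq, Matrix.trace_diagonal]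
  rfl

section Character

open FGModuleCat

variable {K : Type u} [Field K] [CharZero K] {P : FGModuleCat.{u} K ⥤ FGModuleCat.{u} K} {k : ℕ}

/-- By `trace_lmap` the trace of `P(f)` is a fixed combination of products of the traces of powers
of `f`; for diagonal `f` these are power sums of the entries. -/
theorem exists_isCharacter (hP : IsHomogeneousPolynomialFunctor P k) :
    ∃ F : SymFun K, IsCharacter P F := by
  refine ⟨∑ σ : Equiv.Perm (Fin k), permCoeff hP (fun _ => LinearMap.id) σ •
    (σ.partition.parts.map fun l => SymFun.p K l).prod, fun n a _ => ?_⟩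
  have h := trace_lmap hP (coordSpace K n) (Matrix.toLin' (Matrix.diagonal a))
  refine Eq.trans ?_ h.symm
  rw [← SymFun.evalHom_apply, map_sum]
  refine Finset.sum_congr rfl fun σ _ => ?_
  rw [map_smul, SymFun.evalHom_prod_p, smul_eq_mul]
  exact congrArg _ (congrArg Multiset.prod (Multiset.map_congr rfl fun l _ =>
    (trace_toLin_diagonal_pow a l).symm))

theorem IsCharacter.unique {F F' : SymFun K} (hF : IsCharacter P F) (hF' : IsCharacter P F') :
    F = F' :=
  SymFun.ext_of_evalAt _ _ fun n a ha => (hF n a ha).trans (hF' n a ha).symm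

/-- The plethysms with power sums of the character of `P` give the characters of the natural
endomorphisms of `P(V)^{⊗ r}` that permute the tensor factors. -/
theorem IsCharacter.prod_adams {F : SymFun K} (hF : IsCharacter P F)
    (hP : IsHomogeneousPolynomialFunctor P k) {r : ℕ} (π : Equiv.Perm (Fin r)) :
    (π.partition.parts.map fun l => SymFun.adams K l.toPNat' F).prod =
      ∑ σ : Equiv.Perm (Fin (r * k)),
        permCoeff (isHomogeneousPolynomialFunctor_tensorFunctor hP r) (permTensor P r π) σ •
          (σ.partition.parts.map fun l => SymFun.p K l).prod := by
  refine SymFun.ext_of_evalAt _ _ fun n a ha => ?_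
  rw [← SymFun.evalHom_apply, ← SymFun.evalHom_apply, map_multiset_prod, Multiset.map_map, map_sum]
  -- At a diagonal `A` the factor `p_l[F]` takes the value of `F` at the `l`-th powers of the
  -- entries, which is `tr P(A^l)`.
  have h := prod_trace_lmap_pow hP r π (coordSpace K n) (Matrix.toLin' (Matrix.diagonal a))
  refine Eq.trans ?_ (h.trans ?_)
  · refine congrArg Multiset.prod (Multiset.map_congr rfl fun l hl => ?_)
    have hl' : ((l.toPNat' : ℕ+) : ℕ) = l := by
      rw [Nat.toPNat'_coe, if_pos (π.partition.parts_pos hl)]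
    have h1 : Matrix.toLin' (Matrix.diagonal a) ^ l =
        Matrix.toLin' (Matrix.diagonal fun i => a i ^ l) := by
      rw [← Matrix.toLin'_pow, Matrix.diagonal_pow]
      rfl
    refine Eq.trans ?_ (congrArg (fun f => LinearMap.trace K _ (lmap P (U := coordSpace K n)
      (W := coordSpace K n) f)) h1).symm
    rw [Function.comp_apply, SymFun.evalHom_adams, hl', SymFun.evalHom_apply]
    -- `IsCharacter` speaks of invertible matrices only; powers of nonzero entries stay nonzero.
    exact hF n _ fun i => pow_ne_zero l (ha i)
  · refine Finset.sum_congr rfl fun σ _ => ?_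
    rw [map_smul, SymFun.evalHom_prod_p, smul_eq_mul]
    exact congrArg _ (congrArg Multiset.prod (Multiset.map_congr rfl fun l _ =>
      trace_toLin_diagonal_pow a l))

theorem scalar_prod_p_invariantCharacter {G : Type*} [Group G] {V : Type*} [AddCommGroup V]
    [Module K V] [Module.Finite K V] (ρ : Representation K G V) (n : ℕ)
    (σ : Equiv.Perm (Fin n)) :
    SymFun.scalar K (σ.partition.parts.map fun i => SymFun.p K i).prod (invariantCharacter ρ n) =
      LinearMap.trace K _ (permInvariants ρ n σ) :=
  SymFun.scalar_prod_p_sum (fun τ => LinearMap.trace K _ (permInvariants ρ n τ))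
    (fun _ _ h => trace_permInvariants_of_isConj ρ n h) σ

/-- The two trace formulas meet here: pairing with `invariantCharacter` replaces each `p_{λ(σ)}` in
`prod_adams` by the trace of `σ` on the invariants, and the shared coefficients reassemble the trace
of `π`. -/
theorem IsCharacter.scalar_prod_adams {F : SymFun K} (hF : IsCharacter P F)
    (hP : IsHomogeneousPolynomialFunctor P k) {G : Type w} [Group G] {V : FGModuleCat.{u} K}
    (ρ : Representation K G V) {r : ℕ} (π : Equiv.Perm (Fin r)) :
    SymFun.scalar K (π.partition.parts.map fun l => SymFun.adams K l.toPNat' F).prod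
      (invariantCharacter ρ (r * k)) =
      LinearMap.trace K _ (permInvariants (mapRep P ρ) r π) := by
  rw [hF.prod_adams hP, map_sum, LinearMap.sum_apply, trace_permInvariants_mapRep hP]
  refine Finset.sum_congr rfl fun σ _ => ?_
  rw [map_smul, LinearMap.smul_apply, scalar_prod_p_invariantCharacter, smul_eq_mul]

end Character

theorem mainTheorem2 {K : Type u} [Field K] [CharZero K] {G : Type w} [Group G]
    (P : FGModuleCat.{u} K ⥤ FGModuleCat.{u} K) (k : ℕ)
    (hP : IsHomogeneousPolynomialFunctor P k)
    (V : FGModuleCat.{u} K) (ρ : Representation K G V) :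
    (∃! F : SymFun K, IsCharacter P F) ∧
      ∀ F : SymFun K, IsCharacter P F → ∀ r : ℕ,
        invariantCharacter (mapRep P ρ) r =
          SymFun.scalarY
            (SymFun.plethysm (SymFun.adamsXY K) (SymFun.h K r)
              (SymFun.inX (SymFun.p K 1) * SymFun.inY F))
            (invariantCharacter ρ (r * k)) := by
  obtain ⟨F₀, hF₀⟩ := exists_isCharacter hP
  refine ⟨⟨F₀, hF₀, fun F hF => hF.unique hF₀⟩, fun F hF r => ?_⟩
  -- Both sides are now averages over `π` of multiples of `p_{λ(π)}[X]`, and the coefficients agree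
  -- term by term.
  rw [SymFun.plethysm_h, SymFun.scalarY_smul_sum, invariantCharacter]
  congr 1
  refine Finset.sum_congr rfl fun π _ => ?_
  rw [SymFun.scalarY_tmul, hF.scalar_prod_adams hP]
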